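/- Let $L=\begin{pmatrix}1&0\\1&1\end{pmatrix}$ and $R=\begin{pmatrix}1&1\\0&1\end{pmatrix}$, which freely generate the monoid $\mathrm{SL}_2(\mathbb N)$ of matrices in $\mathrm{SL}_2(\mathbb Z)$ with non-negative entries. For $A\in \mathrm{SL}_2(\mathbb N)$, let $\mathrm{Rad}(A)=\#R-\#L$ be the difference between the numbers of letters $R$ and $L$ in the $\{L,R\}$-factorisation of $A$. Let $A_q$ be the matrix over $\mathbb Z[q^{\pm1}]$ obtained from this factorisation by the substitution of $L_q=\begin{pmatrix}q&0\\1&q^{-1}\end{pmatrix}$ for $L$ and $R_q=\begin{pmatrix}q&1\\0&q^{-1}\end{pmatrix}$ for $R$. Let $B_3=\langle\sigma_1,\sigma_2\mid \sigma_1\sigma_2\sigma_1=\sigma_2\sigma_1\sigma_2\rangle$ be the braid group on three strands, and let $\sigma_A\in B_3$ be the image of $A$ by the morphism of monoids $L\mapsto\sigma_1^{-1}$, $R\mapsto\sigma_2$. Finally, let $U=\mathrm{PSL}_2(\mathbb Z)\backslash \mathrm{PSL}_2(\mathbb R)$ be the unit tangent bundle of the modular orbifold, with the identification $\pi_1(U)=B_3$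 in which $\sigma_1^{-1}$ and $\sigma_2$ are the classes of the loops $s\mapsto \begin{pmatrix}1&0\\s&1\end{pmatrix}$ and $s\mapsto\begin{pmatrix}1&s\\0&1\end{pmatrix}$, $0\le s\le 1$. Suppose that $A\in \mathrm{SL}_2(\mathbb N)$ is hyperbolic, and primitive in $\mathrm{PSL}_2(\mathbb Z)$ (it generates a maximal cyclic subgroup). Then the modular knot of $A$ (the periodic orbit of the geodesic flow in $U$ that lifts the closed geodesic of $A$) is freely homotopic in $U$ to the loop of $\sigma_A$. Moreover, the one-variable Alexander polynomial $\Delta(t)\in\mathbb Z[t^{\pm1}]$ of the link obtained as the closure of $\sigma_A$ (or of any braid word that represents a conjugate of $\sigma_A$ in $B_3$) is given in terms of $q=\sqrt{-t}$, that is $t=-q^2$, by $$\Delta(-q^2)\doteq\frac{q^{\mathrm{Rad}(A)}-\mathrm{Tr}(A_q)+q^{-\mathrm{Rad}(A)}}{q^2-1+q^{-2}},$$ where $\doteq$ denotes equality up to multiplication by a unit $\pm q^{n}$ of $\mathbb Z[q^{\pm1}]$ (the Alexander polynomial itself is defined up to multiplication by a unit $\pm t^n$). -/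

import Mathlib

open scoped MatrixGroups LaurentPolynomial unitInterval

noncomputable section

namespace ModularBraid

/-! ### The monoid `SL₂(ℕ)` and `{L, R}`-words -/

/-- The two letters `L` and `R`. -/
inductive Letter : Type
  | L : Letter
  | R : Letter

/-- The transvections `L = (1 0; 1 1)` and `R = (1 1; 0 1)`. -/
def Letter.toSL : Letter → SL(2, ℤ)
  | .L => ⟨!![1, 0; 1, 1], by simp [Matrix.det_fin_two]⟩
  | .R => ⟨!![1, 1; 0, 1], by simp [Matrix.det_fin_two]⟩

/-- The product in `SL₂(ℤ)` of an `{L, R}`-word. -/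
def wordProd (w : List Letter) : SL(2, ℤ) := (w.map Letter.toSL).prod

/-- `SL₂(ℕ)`: the submonoid of `SL₂(ℤ)` of matrices with non-negative entries. -/
def SL2N : Submonoid SL(2, ℤ) where
  carrier := {A | ∀ i j, 0 ≤ A i j}
  one_mem' := by
    intro i j
    fin_cases i <;> fin_cases j <;> simp
  mul_mem' := by
    intro A B hA hB i j
    rw [Matrix.SpecialLinearGroup.coe_mul, Matrix.mul_apply]
    exact Finset.sum_nonneg fun k _ => mul_nonneg (hA i k) (hB k j)

theorem wordProd_cons (x : Letter) (w : List Letter) :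
    wordProd (x :: w) = x.toSL * wordProd w := by
  rw [wordProd, List.map_cons, List.prod_cons, wordProd]

theorem wordProd_cons_L (w : List Letter) :
    wordProd (Letter.L :: w) 0 0 = wordProd w 0 0 ∧ wordProd (Letter.L :: w) 0 1 = wordProd w 0 1 ∧
    wordProd (Letter.L :: w) 1 0 = wordProd w 0 0 + wordProd w 1 0 ∧
    wordProd (Letter.L :: w) 1 1 = wordProd w 0 1 + wordProd w 1 1 := by
  rw [wordProd_cons, Matrix.SpecialLinearGroup.coe_mul]
  simp [Letter.toSL, Matrix.mul_apply, Fin.sum_univ_two]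

theorem wordProd_cons_R (w : List Letter) :
    wordProd (Letter.R :: w) 0 0 = wordProd w 0 0 + wordProd w 1 0 ∧
    wordProd (Letter.R :: w) 0 1 = wordProd w 0 1 + wordProd w 1 1 ∧
    wordProd (Letter.R :: w) 1 0 = wordProd w 1 0 ∧ wordProd (Letter.R :: w) 1 1 = wordProd w 1 1 := by
  rw [wordProd_cons, Matrix.SpecialLinearGroup.coe_mul]
  simp [Letter.toSL, Matrix.mul_apply, Fin.sum_univ_two]

theorem det_eq (A : SL(2, ℤ)) : A 0 0 * A 1 1 - A 0 1 * A 1 0 = 1 := by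
  have h := A.det_coe
  rwa [Matrix.det_fin_two] at h

theorem ext_entries {A B : SL(2, ℤ)} (h00 : A 0 0 = B 0 0) (h01 : A 0 1 = B 0 1)
    (h10 : A 1 0 = B 1 0) (h11 : A 1 1 = B 1 1) : A = B := by
  ext i j
  fin_cases i <;> fin_cases j <;> assumption

theorem wordProd_nonneg (w : List Letter) : ∀ i j, 0 ≤ wordProd w i j := by
  induction w with
  | nil => exact SL2N.one_mem
  | cons x w ih =>
    have h00 := ih 0 0
    have h01 := ih 0 1
    have h10 := ih 1 0
    have h11 := ih 1 1
    cases x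
    · obtain ⟨a, b, c, d⟩ := wordProd_cons_L w
      intro i j
      fin_cases i <;> fin_cases j <;> simp only [Fin.zero_eta, Fin.mk_one] <;> omega
    · obtain ⟨a, b, c, d⟩ := wordProd_cons_R w
      intro i j
      fin_cases i <;> fin_cases j <;> simp only [Fin.zero_eta, Fin.mk_one] <;> omega

theorem exists_word (n : ℕ) : ∀ A : SL(2, ℤ), A ∈ SL2N →
    A 0 0 + A 0 1 + A 1 0 + A 1 1 ≤ n → ∃ w, wordProd w = A := by
  induction n with
  | zero =>
    intro A hA hn
    have h := det_eq A
    have h00 := hA 0 0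
    have h01 := hA 0 1
    have h10 := hA 1 0
    have h11 := hA 1 1
    push_cast at hn
    have e : A 0 0 = 0 := by omega
    have e' : A 0 1 = 0 := by omega
    rw [e, e'] at h
    simp at h
  | succ n ih =>
    intro A hA hn
    have h := det_eq A
    have h00 := hA 0 0
    have h01 := hA 0 1
    have h10 := hA 1 0
    have h11 := hA 1 1
    push_cast at hn
    by_cases hR : A 1 0 ≤ A 0 0 ∧ A 1 1 ≤ A 0 1
    · let B : SL(2, ℤ) := ⟨!![A 0 0 - A 1 0, A 0 1 - A 1 1; A 1 0, A 1 1], by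
        rw [Matrix.det_fin_two]; simp; linarith⟩
      have b00 : B 0 0 = A 0 0 - A 1 0 := rfl
      have b01 : B 0 1 = A 0 1 - A 1 1 := rfl
      have b10 : B 1 0 = A 1 0 := rfl
      have b11 : B 1 1 = A 1 1 := rfl
      have hpos : 0 < A 1 0 + A 1 1 := by
        by_contra hc
        have e : A 1 0 = 0 := by omega
        have e' : A 1 1 = 0 := by omega
        rw [e, e'] at h
        simp at h
      obtain ⟨w, hw⟩ := ih B
        (by intro i j; fin_cases i <;> fin_cases j <;> simp only [Fin.zero_eta, Fin.mk_one] <;> omega)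
        (by omega)
      obtain ⟨a, b, c, d⟩ := wordProd_cons_R w
      rw [hw] at a b c d
      exact ⟨Letter.R :: w, ext_entries (by omega) (by omega) (by omega) (by omega)⟩
    by_cases hL : A 0 0 ≤ A 1 0 ∧ A 0 1 ≤ A 1 1
    · let B : SL(2, ℤ) := ⟨!![A 0 0, A 0 1; A 1 0 - A 0 0, A 1 1 - A 0 1], by
        rw [Matrix.det_fin_two]; simp; linarith⟩
      have b00 : B 0 0 = A 0 0 := rfl
      have b01 : B 0 1 = A 0 1 := rfl
      have b10 : B 1 0 = A 1 0 - A 0 0 := rfl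
      have b11 : B 1 1 = A 1 1 - A 0 1 := rfl
      have hpos : 0 < A 0 0 + A 0 1 := by
        by_contra hc
        have e : A 0 0 = 0 := by omega
        have e' : A 0 1 = 0 := by omega
        rw [e, e'] at h
        simp at h
      obtain ⟨w, hw⟩ := ih B
        (by intro i j; fin_cases i <;> fin_cases j <;> simp only [Fin.zero_eta, Fin.mk_one] <;> omega)
        (by omega)
      obtain ⟨a, b, c, d⟩ := wordProd_cons_L w
      rw [hw] at a b c d
      exact ⟨Letter.L :: w, ext_entries (by omega) (by omega) (by omega) (by omega)⟩
    · refine ⟨[], ?_⟩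
      have key : A 0 1 = 0 ∧ A 1 0 = 0 := by
        rcases lt_or_ge (A 0 0) (A 1 0) with h1 | h1
        · have h2 : A 1 1 < A 0 1 := by
            by_contra hc
            exact hL ⟨h1.le, not_lt.mp hc⟩
          nlinarith [mul_nonneg h00 h11]
        · have h2 : A 0 1 < A 1 1 := by
            by_contra hc
            exact hR ⟨h1, not_lt.mp hc⟩
          have h3 : A 1 0 < A 0 0 := by
            by_contra hc
            exact hL ⟨not_lt.mp hc, h2.le⟩
          constructor <;> nlinarith [mul_nonneg (sub_nonneg.mpr (Int.add_one_le_iff.mpr h2))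
            (sub_nonneg.mpr (Int.add_one_le_iff.mpr h3))]
      rw [key.1, key.2] at h
      have hu : A 0 0 = 1 ∧ A 1 1 = 1 := by
        have h' : A 0 0 * A 1 1 = 1 := by linarith
        rcases Int.mul_eq_one_iff_eq_one_or_neg_one.mp h' with h' | h'
        · exact h'
        · omega
      refine ext_entries ?_ ?_ ?_ ?_ <;> simp [wordProd, key.1, key.2, hu.1, hu.2]

theorem wordProd_injective : Function.Injective wordProd := by
  intro v
  induction v with
  | nil =>
    intro w h
    cases w with
    | nil => rfl
    | cons y w =>
      exfalso
      have n00 := wordProd_nonneg w 0 0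
      have n01 := wordProd_nonneg w 0 1
      have n10 := wordProd_nonneg w 1 0
      have n11 := wordProd_nonneg w 1 1
      have e00 : wordProd [] 0 0 = 1 := by simp [wordProd]
      have e01 : wordProd [] 0 1 = 0 := by simp [wordProd]
      have e10 : wordProd [] 1 0 = 0 := by simp [wordProd]
      have e11 : wordProd [] 1 1 = 1 := by simp [wordProd]
      rw [h] at e00 e01 e10 e11
      cases y
      · obtain ⟨a, b, c, d⟩ := wordProd_cons_L w
        omega
      · obtain ⟨a, b, c, d⟩ := wordProd_cons_R w
        omega
  | cons x v ih =>
    intro w h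
    have m00 := wordProd_nonneg v 0 0
    have m01 := wordProd_nonneg v 0 1
    have m10 := wordProd_nonneg v 1 0
    have m11 := wordProd_nonneg v 1 1
    cases w with
    | nil =>
      exfalso
      have e00 : wordProd [] 0 0 = 1 := by simp [wordProd]
      have e01 : wordProd [] 0 1 = 0 := by simp [wordProd]
      have e10 : wordProd [] 1 0 = 0 := by simp [wordProd]
      have e11 : wordProd [] 1 1 = 1 := by simp [wordProd]
      rw [← h] at e00 e01 e10 e11
      cases x
      · obtain ⟨a, b, c, d⟩ := wordProd_cons_L v
        omega
      · obtain ⟨a, b, c, d⟩ := wordProd_cons_R v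
        omega
    | cons y w =>
      have n00 := wordProd_nonneg w 0 0
      have n01 := wordProd_nonneg w 0 1
      have n10 := wordProd_nonneg w 1 0
      have n11 := wordProd_nonneg w 1 1
      have hd := det_eq (wordProd v)
      cases x <;> cases y
      · rw [ih (a₂ := w) (by
          rw [wordProd_cons, wordProd_cons] at h
          exact mul_left_cancel h)]
      · exfalso
        obtain ⟨a, b, c, d⟩ := wordProd_cons_L v
        obtain ⟨a', b', c', d'⟩ := wordProd_cons_R w
        rw [h] at a b c d
        have e : wordProd v 1 0 = 0 := by omega
        have e' : wordProd v 1 1 = 0 := by omega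
        rw [e, e'] at hd
        simp at hd
      · exfalso
        obtain ⟨a, b, c, d⟩ := wordProd_cons_R v
        obtain ⟨a', b', c', d'⟩ := wordProd_cons_L w
        rw [h] at a b c d
        have e : wordProd v 0 0 = 0 := by omega
        have e' : wordProd v 0 1 = 0 := by omega
        rw [e, e'] at hd
        simp at hd
      · rw [ih (a₂ := w) (by
          rw [wordProd_cons, wordProd_cons] at h
          exact mul_left_cancel h)]

/-- `SL₂(ℕ)` is freely generated by `L` and `R`. -/
theorem existsUnique_word (A : SL2N) : ∃! w, wordProd w = A := by
  obtain ⟨w, hw⟩ := exists_word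
    (A.1 0 0 + A.1 0 1 + A.1 1 0 + A.1 1 1).toNat A.1 A.2 (Int.self_le_toNat _)
  exact ⟨w, hw, fun v hv => wordProd_injective (hv.trans hw.symm)⟩

/-- The unique `{L, R}`-word whose product is `A ∈ SL₂(ℕ)`. -/
def word (A : SL2N) : List Letter := (existsUnique_word A).choose

/-- The exponent `+1` of `R`, and `-1` of `L`. -/
def Letter.sign : Letter → ℤ
  | .L => -1
  | .R => 1

/-- The Rademacher number `Rad(A) = #R - #L`. -/
def Rad (A : SL2N) : ℤ := ((word A).map Letter.sign).sum

/-- The deformed generators `L_q = (q 0; 1 q⁻¹)` and `R_q = (q 1; 0 q⁻¹)` over `ℤ[q, q⁻¹]`;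
here the Laurent variable `T` is `q`. -/
def Letter.deformed : Letter → Matrix (Fin 2) (Fin 2) ℤ[T;T⁻¹]
  | .L => !![LaurentPolynomial.T 1, 0; 1, LaurentPolynomial.T (-1)]
  | .R => !![LaurentPolynomial.T 1, 1; 0, LaurentPolynomial.T (-1)]

/-- The matrix `A_q`. -/
def deform (A : SL2N) : Matrix (Fin 2) (Fin 2) ℤ[T;T⁻¹] :=
  ((word A).map Letter.deformed).prod

/-- An element of a group is primitive when it generates a maximal cyclic subgroup. -/
def IsPrimitiveElement {G : Type*} [Group G] (g : G) : Prop :=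
  ∀ h : G, Subgroup.zpowers g ≤ Subgroup.zpowers h → Subgroup.zpowers h = Subgroup.zpowers g

/-! ### The braid group on three strands -/

/-- The braid relation `σ₁σ₂σ₁ = σ₂σ₁σ₂`; the generator `σ₁` has index `0`, and `σ₂` index `1`. -/
def braidRels : Set (FreeGroup (Fin 2)) :=
  {FreeGroup.of 0 * FreeGroup.of 1 * FreeGroup.of 0 *
    (FreeGroup.of 1 * FreeGroup.of 0 * FreeGroup.of 1)⁻¹}

/-- The braid group `B₃`. -/
abbrev B₃ : Type := PresentedGroup braidRels

/-- Words in `σ₁^{±1}, σ₂^{±1}`; the pair `(i, true)` stands for the generator of index `i`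
and `(i, false)` for its inverse. -/
abbrev BraidWord : Type := List (Fin 2 × Bool)

/-- The braid represented by a braid word. -/
def BraidWord.toBraid (w : BraidWord) : B₃ := PresentedGroup.mk braidRels (FreeGroup.mk w)

/-- `L ↦ σ₁⁻¹` and `R ↦ σ₂`. -/
def Letter.toBraidLetter : Letter → Fin 2 × Bool
  | .L => (0, false)
  | .R => (1, true)

/-- The word of the braid `σ_A`. -/
def sigmaWord (A : SL2N) : BraidWord := (word A).map Letter.toBraidLetter

/-- The braid `σ_A`: the image of `A` by the monoid morphism `(L, R) ↦ (σ₁⁻¹, σ₂)`. -/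
def sigma (A : SL2N) : B₃ := BraidWord.toBraid (sigmaWord A)

/-! ### The unit tangent bundle of the modular orbifold and modular knots -/

/-- The image of `SL₂(ℤ)` in `SL₂(ℝ)`. -/
def modularSubgroup : Subgroup SL(2, ℝ) :=
  (Matrix.SpecialLinearGroup.map (n := Fin 2) (Int.castRingHom ℝ)).range

/-- The space `SL₂(ℤ)\SL₂(ℝ) = PSL₂(ℤ)\PSL₂(ℝ)` of cosets `SL₂(ℤ)g` with the quotient topology:
the unit tangent bundle of the modular orbifold. -/
abbrev UnitTangent : Type := Quotient (QuotientGroup.rightRel modularSubgroup)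

/-- The projection `g ↦ SL₂(ℤ)g`. -/
def proj (g : SL(2, ℝ)) : UnitTangent := Quotient.mk _ g

theorem continuous_proj : Continuous proj := continuous_quotient_mk'

/-- The base point of the unit tangent bundle. -/
def base : UnitTangent := proj 1

/-- Cosets do not change under left multiplication by an element of `SL₂(ℤ)`. -/
theorem proj_mul (A : SL(2, ℤ)) (g : SL(2, ℝ)) :
    proj (Matrix.SpecialLinearGroup.map (Int.castRingHom ℝ) A * g) = proj g := by
  apply Quotient.sound
  change QuotientGroup.rightRel modularSubgroup _ _
  rw [QuotientGroup.rightRel_apply]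
  simp only [mul_inv_rev, mul_inv_cancel_left]
  exact inv_mem ⟨A, rfl⟩

/-- The unipotent matrices `L^s = (1 0; s 1)` and `R^s = (1 s; 0 1)`. -/
def Letter.unipotent : Letter → ℝ → SL(2, ℝ)
  | .L, s => ⟨!![1, 0; s, 1], by simp [Matrix.det_fin_two]⟩
  | .R, s => ⟨!![1, s; 0, 1], by simp [Matrix.det_fin_two]⟩

theorem Letter.continuous_unipotent (x : Letter) : Continuous x.unipotent := by
  cases x <;>
  · refine Continuous.subtype_mk (continuous_matrix ?_) _
    intro i j
    fin_cases i <;> fin_cases j <;> simp <;> fun_prop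

/-- The loop `s ↦ SL₂(ℤ)·x^s`, for `x = L` or `R` and `0 ≤ s ≤ 1`. -/
def Letter.loop (x : Letter) : Path base base where
  toFun s := proj (x.unipotent s)
  continuous_toFun :=
    continuous_proj.comp (x.continuous_unipotent.comp continuous_subtype_val)
  source' := by
    have h : x.unipotent 0 = 1 := by
      cases x <;> ext i j <;> fin_cases i <;> fin_cases j <;> simp [Letter.unipotent]
    simp [h, base]
  target' := by
    have h : x.unipotent 1 =
        Matrix.SpecialLinearGroup.map (Int.castRingHom ℝ) x.toSL * 1 := by
      rw [mul_one]
      ext i j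
      rw [Matrix.SpecialLinearGroup.map_apply_coe]
      cases x <;> fin_cases i <;> fin_cases j <;> simp [Letter.unipotent, Letter.toSL]
    simp only [Set.Icc.coe_one, h, base, proj_mul]

/-- The loops of `σ₁^{±1}` and `σ₂^{±1}`: those of `σ₁⁻¹` and `σ₂` are the loops of `L` and `R`. -/
def genLoop : Fin 2 × Bool → Path base base
  | (0, true) => Letter.L.loop.symm
  | (0, false) => Letter.L.loop
  | (1, true) => Letter.R.loop
  | (1, false) => Letter.R.loop.symm

/-- The loop of a braid word under the identification of `B₃` with the fundamental group of the
unit tangent bundle: the concatenation of the loops of its letters. -/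
def braidLoop : BraidWord → Path base base
  | [] => Path.refl base
  | x :: w => (genLoop x).trans (braidLoop w)

/-- Free homotopy of loops. -/
def FreelyHomotopic {X : Type*} [TopologicalSpace X] (γ₀ γ₁ : C(I, X)) : Prop :=
  ContinuousMap.HomotopicWith γ₀ γ₁ fun γ => γ 0 = γ 1

/-- The matrix `diag(e^s, e^{-s})`; right multiplication by it is the geodesic flow
at time `2s`. -/
def flow (s : ℝ) : SL(2, ℝ) :=
  ⟨!![Real.exp s, 0; 0, Real.exp (-s)], by simp [Matrix.det_fin_two, ← Real.exp_add]⟩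

/-- `γ` is the modular knot of a hyperbolic `A` of positive trace, parametrised proportionally to
arc length: the orbit of the geodesic flow through a unit vector `g` of the axis of `A`, pointing
to the attractive fixed point, from `g` to `A g`. -/
def IsModularKnot (A : SL(2, ℤ)) (γ : C(I, UnitTangent)) : Prop :=
  ∃ (g : SL(2, ℝ)) (l : ℝ), 0 < l ∧
    Matrix.SpecialLinearGroup.map (Int.castRingHom ℝ) A * g = g * flow l ∧
    ∀ s : I, γ s = proj (g * flow (s * l))

/-! ### Alexander polynomials of oriented link diagrams -/

/-- A vertex of an oriented link diagram that is cut into oriented segments (with set `S`): either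
a point where the segment `a` is continued by the segment `b`, or a crossing (positive if `pos` is
true, and negative otherwise), where `overIn` is continued by `overOut` on the upper strand, and
`underIn` by `underOut` on the lower strand. -/
inductive Vertex (S : Type) : Type
  | joint (a b : S) : Vertex S
  | crossing (pos : Bool) (overIn overOut underIn underOut : S) : Vertex S

/-- The incidence data of an oriented link diagram: the finite set of its segments and its
vertices. -/
structure Diagram : Type 1 where
  Seg : Type
  [fintype : Fintype Seg]
  [decEq : DecidableEq Seg]
  vertices : Set (Vertex Seg)

attribute [instance] Diagram.fintype Diagram.decEq

/-- The variable `t` at a positive crossing, and `t⁻¹` at a negative crossing. -/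
def crossingVar (pos : Bool) : ℤ[T;T⁻¹] := LaurentPolynomial.T (if pos then 1 else -1)

/-- The rows of the Alexander matrix at a vertex: the abelianised Fox derivatives of the Wirtinger
relations, every meridian being sent to `t`. At a joint the relation is `b = a`. At a crossing the
relations are `overOut = overIn` and `underOut = o^ε underIn o^{-ε}` with `o = overIn` and `ε` the
sign of the crossing. -/
def Vertex.rows {S : Type} [DecidableEq S] : Vertex S → Set (S → ℤ[T;T⁻¹])
  | .joint a b => {Pi.single a 1 - Pi.single b 1}
  | .crossing pos overIn overOut underIn underOut =>
    {Pi.single overIn 1 - Pi.single overOut 1,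
      crossingVar pos • Pi.single underIn 1 + (1 - crossingVar pos) • Pi.single overIn 1 -
        Pi.single underOut 1}

/-- The rows of the Alexander matrix of a diagram; its columns are indexed by the segments. -/
def Diagram.rows (D : Diagram) : Set (D.Seg → ℤ[T;T⁻¹]) := ⋃ v ∈ D.vertices, v.rows

/-- The Alexander ideal (first elementary ideal): with `n` columns, it is generated by the minors
of size `n - 1` of the Alexander matrix. -/
def Diagram.alexanderIdeal (D : Diagram) : Ideal ℤ[T;T⁻¹] :=
  Ideal.span {d | ∃ (r : Fin (Fintype.card D.Seg - 1) → D.Seg → ℤ[T;T⁻¹])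
    (c : Fin (Fintype.card D.Seg - 1) → D.Seg),
    (∀ i, r i ∈ D.rows) ∧ d = (Matrix.of fun i j => r i (c j)).det}

/-- `P ∈ ℤ[t, t⁻¹]` is the (one-variable) Alexander polynomial of the link with diagram `D`: it
generates the smallest principal ideal that contains the Alexander ideal. It is defined up to a
unit. -/
def Diagram.IsAlexanderPolynomial (D : Diagram) (P : ℤ[T;T⁻¹]) : Prop :=
  D.alexanderIdeal ≤ Ideal.span {P} ∧
    ∀ Q : ℤ[T;T⁻¹], D.alexanderIdeal ≤ Ideal.span {Q} → Q ∣ P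

/-- The vertices between the heights `a` and `b` of a three-strand braid, for one letter. The strands
run upwards, the segment of the strand in position `i` at height `a` is `(a, i)`. The generator of
index `i` is the positive crossing of the positions `i` and `i + 1` in which the strand that goes
from `i` to `i + 1` is the upper one; its inverse is the negative crossing in which the strand that
goes from `i + 1` to `i` is the upper one. The third strand, in position `k`, goes straight up. -/
def braidLetterVertices {H : Type} (a b : H) : Fin 2 × Bool → Set (Vertex (H × Fin 3))
  | (i, true) => {Vertex.crossing true (a, i.castSucc) (b, i.succ) (a, i.succ) (b, i.castSucc)} ∪
      {v | ∃ k, k ≠ i.castSucc ∧ k ≠ i.succ ∧ v = Vertex.joint (a, k) (b, k)}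
  | (i, false) => {Vertex.crossing false (a, i.succ) (b, i.castSucc) (a, i.castSucc) (b, i.succ)} ∪
      {v | ∃ k, k ≠ i.castSucc ∧ k ≠ i.succ ∧ v = Vertex.joint (a, k) (b, k)}

/-- The diagram of the closure of the braid word `w`: its segments lie at the heights
`0, …, length w`, and the segments at the top are continued by those at the bottom. -/
def closure (w : BraidWord) : Diagram where
  Seg := Fin (w.length + 1) × Fin 3
  vertices :=
    (⋃ k : Fin w.length, braidLetterVertices k.castSucc k.succ (w.get k)) ∪
      Set.range fun i : Fin 3 => Vertex.joint (Fin.last w.length, i) (0, i)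

/-- The unit `-q²` of `ℤ[q, q⁻¹]`. -/
def negSq : (ℤ[T;T⁻¹])ˣ where
  val := -LaurentPolynomial.T 2
  inv := -LaurentPolynomial.T (-2)
  val_inv := by rw [neg_mul_neg, ← LaurentPolynomial.T_add]; simp
  inv_val := by rw [neg_mul_neg, ← LaurentPolynomial.T_add]; simp

/-- The substitution `t = -q²`, from `ℤ[t, t⁻¹]` to `ℤ[q, q⁻¹]`. -/
def substNegSq : ℤ[T;T⁻¹] →+* ℤ[T;T⁻¹] :=
  LaurentPolynomial.eval₂ (algebraMap ℤ ℤ[T;T⁻¹]) negSq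

end ModularBraid

end

/-! The two assertions are independent.

Homotopy. The loop of `σ_A` lifts to a path in `SL₂(ℝ)` from `1` to `A` whose entries are
non-negative (`exists_lift_braidLoop`), hence with a positive first entry. After right translation
by `g⁻¹`, the modular knot lifts to the one-parameter path `g · flow · g⁻¹`, also from `1` to `A`
and also with a positive first entry (`pos_corner_conj_flow`). Matrices `(a b; c d)` of determinant
`1` with `a > 0` form a convex set in the coordinates `a, b, c`, so the two paths are homotopic with
fixed ends. A path from `1` to `g` undoes the translation, at the cost of moving the base point.

Alexander polynomial. The Alexander matrix of a closed braid is a cyclic block matrix. Elimination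
of the heights reduces its first minor to that of `B - 1`, where `B` is the transposed Burau matrix
(`associated_adjugate_alexanderMatrix`). A relation between the columns and one between the rows
make this minor a generator of the Alexander ideal (`alexanderIdeal_closure`). The same relations
for `B - 1` make its diagonal cofactors proportional to `1, t, t²`, so that the minor times `1 + t +
t²` is `det B - tr B + 2` (`adjugate_segmentProd_sub_one`), which depends only on the conjugacy
class of the braid. At `t = -q²` the Burau matrices of `σ₁⁻¹` and `σ₂` are block triangular, with
blocks `q⁻¹ L_q`, respectively `q R_q`, and `1`. Hence `det B = q^{2 Rad}` and `tr B = q^{Rad}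
Tr(A_q) + 1`. -/

/-! ### Minors and adjugates -/

section Adjugate

variable {R : Type*} [CommRing R]

/-- An injection `Fin m → Fin (m + 1)` is, up to a permutation, the embedding that misses one
element. -/
theorem exists_eq_succAbove_comp_perm {m : ℕ} {f : Fin m → Fin (m + 1)}
    (hf : Function.Injective f) :
    ∃ (j : Fin (m + 1)) (e : Equiv.Perm (Fin m)), f = j.succAbove ∘ e := by
  have hns : ¬ Function.Surjective f := by
    intro hs
    have h := Fintype.card_le_of_surjective f hs
    simp at h
  obtain ⟨j, hj⟩ := not_forall.mp hns
  have hj' : ∀ i, ∃ k, j.succAbove k = f i := fun i =>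
    Fin.exists_succAbove_eq fun h => hj ⟨i, h⟩
  choose g hg using hj'
  have hginj : Function.Injective g := fun a b hab => hf (by rw [← hg a, ← hg b, hab])
  refine ⟨j, Equiv.ofBijective g (Finite.injective_iff_bijective.mp hginj), ?_⟩
  funext i
  simp [hg]

/-- A repeated row or column gives zero. Otherwise both selections omit one index, and the minor is
a cofactor up to sign. -/
theorem det_submatrix_mem_span_adjugate {m : ℕ} (A : Matrix (Fin (m + 1)) (Fin (m + 1)) R)
    (f c : Fin m → Fin (m + 1)) :
    (A.submatrix f c).det ∈ Ideal.span (Set.range fun p : Fin (m + 1) × Fin (m + 1) =>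
      A.adjugate p.1 p.2) := by
  by_cases hf : Function.Injective f
  · by_cases hc : Function.Injective c
    · obtain ⟨j, e, rfl⟩ := exists_eq_succAbove_comp_perm hf
      obtain ⟨i, e', rfl⟩ := exists_eq_succAbove_comp_perm hc
      have h1 : A.submatrix (j.succAbove ∘ e) (i.succAbove ∘ e') =
          ((A.submatrix j.succAbove i.succAbove).submatrix id e').submatrix e id := rfl
      have h2 := A.adjugate_fin_succ_eq_det_submatrix i j
      have h3 : (A.submatrix j.succAbove i.succAbove).det =
          (-1) ^ (j + i : ℕ) * A.adjugate i j := by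
        rw [h2, ← mul_assoc, ← mul_pow]
        simp
      rw [h1, Matrix.det_permute, Matrix.det_permute', h3]
      exact Ideal.mul_mem_left _ _ (Ideal.mul_mem_left _ _ (Ideal.mul_mem_left _ _
        (Ideal.subset_span ⟨(i, j), rfl⟩)))
    · obtain ⟨a, b, hab, hne⟩ : ∃ a b, c a = c b ∧ a ≠ b := by
        simpa [Function.Injective] using hc
      rw [Matrix.det_zero_of_column_eq hne (by intro k; simp [hab])]
      exact zero_mem _
  · obtain ⟨a, b, hab, hne⟩ : ∃ a b, f a = f b ∧ a ≠ b := by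
      simpa [Function.Injective] using hf
    rw [Matrix.det_zero_of_row_eq hne (by funext k; simp [hab])]
    exact zero_mem _

/-- The ideal of the minors of corank one of a square matrix is generated by the entries of the
adjugate. -/
theorem span_minors_eq_span_adjugate {S : Type*} [Fintype S] [DecidableEq S] [Nonempty S]
    (A : Matrix S S R) :
    Ideal.span {d | ∃ (r : Fin (Fintype.card S - 1) → S → R) (c : Fin (Fintype.card S - 1) → S),
      (∀ i, r i ∈ Set.range A) ∧ d = (Matrix.of fun i j => r i (c j)).det} =
    Ideal.span (Set.range fun p : S × S => A.adjugate p.1 p.2) := by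
  have e : S ≃ Fin (Fintype.card S - 1 + 1) :=
    Fintype.equivFinOfCardEq (Nat.sub_add_cancel Fintype.card_pos).symm
  generalize Fintype.card S - 1 = m at e
  set B := A.submatrix e.symm e.symm with hB
  have hadj : ∀ i j, B.adjugate i j = A.adjugate (e.symm i) (e.symm j) := by
    intro i j
    rw [hB, Matrix.adjugate_submatrix_equiv_self, Matrix.submatrix_apply]
  apply le_antisymm
  · refine Ideal.span_le.mpr ?_
    rintro d ⟨r, c, hr, rfl⟩
    choose f hf using hr
    have h := det_submatrix_mem_span_adjugate B (e ∘ f) (e ∘ c)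
    have h' : (Matrix.of fun i j => r i (c j)) = B.submatrix (e ∘ f) (e ∘ c) := by
      ext i j
      simp [hB, ← hf]
    rw [SetLike.mem_coe, h']
    refine Ideal.span_mono ?_ h
    rintro _ ⟨p, rfl⟩
    exact ⟨(e.symm p.1, e.symm p.2), (hadj _ _).symm⟩
  · refine Ideal.span_le.mpr ?_
    rintro _ ⟨⟨i, j⟩, rfl⟩
    have h := hadj (e i) (e j)
    rw [e.symm_apply_apply, e.symm_apply_apply, B.adjugate_fin_succ_eq_det_submatrix] at h
    change A.adjugate i j ∈ _
    rw [← h]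
    refine Ideal.mul_mem_left _ _ (Ideal.subset_span ?_)
    exact ⟨fun k => A (e.symm ((e j).succAbove k)), fun k => e.symm ((e i).succAbove k),
      fun k => ⟨_, rfl⟩, rfl⟩

variable [IsDomain R] {S : Type*} [Fintype S] [DecidableEq S]

/-- If the rows of a matrix have sum zero, then the rows of its adjugate are equal. -/
theorem adjugate_eq_of_mulVec_one_eq_zero {A : Matrix S S R} (h : A.mulVec 1 = 0) (i i' j : S) :
    A.adjugate i j = A.adjugate i' j := by
  rw [Matrix.adjugate_apply, Matrix.adjugate_apply, ← sub_eq_zero]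
  -- The new row `j` also has sum zero, so the all-ones vector is still in the kernel.
  have h1 : (A.updateRow j (Pi.single i 1 - Pi.single i' 1)).det = 0 := by
    rw [← Matrix.exists_mulVec_eq_zero_iff]
    refine ⟨1, ?_, ?_⟩
    · intro h0
      simpa using congrFun h0 i
    · funext k
      have hk := congrFun h k
      simp only [Matrix.mulVec, dotProduct, Pi.zero_apply, Pi.one_apply, mul_one] at hk ⊢
      by_cases hkj : k = j
      · subst hkj
        simp
      · simp [Matrix.updateRow_ne hkj, hk]
  have h2 := Matrix.det_updateRow_add A j (Pi.single i 1 - Pi.single i' 1) (Pi.single i' 1)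
  rw [sub_add_cancel, h1, zero_add] at h2
  rw [h2, sub_self]

/-- If `u` is a linear relation between the rows of a matrix, then the columns of its adjugate are
proportional to the entries of `u`. -/
theorem adjugate_mul_eq_of_vecMul_eq_zero {A : Matrix S S R} {u : S → R}
    (h : Matrix.vecMul u A = 0) (i j j' : S) :
    A.adjugate i j * u j' = A.adjugate i j' * u j := by
  by_cases hu : u = 0
  · simp [hu]
  have hadj : ∀ k, A.adjugate i k = (A.updateCol i (Pi.single k 1)).det := by
    intro k
    rw [Matrix.adjugate_def, Matrix.of_apply, Matrix.cramer_apply, Matrix.updateCol_transpose,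
      Matrix.det_transpose, ← Matrix.adjugate_apply, ← Matrix.transpose_apply A.adjugate,
      Matrix.adjugate_transpose, Matrix.adjugate_apply, Matrix.updateRow_transpose,
      Matrix.det_transpose]
  -- The new column is orthogonal to `u`, so `u` remains a relation between the rows.
  have h1 : (A.updateCol i (u j' • Pi.single j 1 + -u j • Pi.single j' 1)).det = 0 := by
    rw [← Matrix.exists_vecMul_eq_zero_iff]
    refine ⟨u, hu, ?_⟩
    funext k
    have hk := congrFun h k
    simp only [Matrix.vecMul, dotProduct, Pi.zero_apply] at hk ⊢
    by_cases hki : k = i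
    · subst hki
      simp [Pi.single_apply, mul_add, Finset.sum_add_distrib, mul_comm]
    · simp [Matrix.updateCol_ne hki, hk]
  rw [Matrix.det_updateCol_add, Matrix.det_updateCol_smul, Matrix.det_updateCol_smul, ← hadj,
    ← hadj] at h1
  linear_combination h1

/-- A square matrix over a domain whose rows have sum zero, and satisfy a linear relation with
coefficient `1` at the row `j`: all its minors of corank one are multiples of one of them. -/
theorem span_adjugate_eq_span_singleton {A : Matrix S S R} {u : S → R} (h : A.mulVec 1 = 0)
    (hu : Matrix.vecMul u A = 0) {i j : S} (hj : u j = 1) :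
    Ideal.span (Set.range fun p : S × S => A.adjugate p.1 p.2) = Ideal.span {A.adjugate i j} := by
  apply le_antisymm
  · refine Ideal.span_le.mpr ?_
    rintro _ ⟨⟨a, b⟩, rfl⟩
    have h1 := adjugate_mul_eq_of_vecMul_eq_zero hu a b j
    rw [hj, mul_one, adjugate_eq_of_mulVec_one_eq_zero h a i j] at h1
    exact Ideal.mem_span_singleton.mpr ⟨u b, h1⟩
  · exact Ideal.span_mono (Set.singleton_subset_iff.mpr ⟨(i, j), rfl⟩)

/-- This is `det (1 + X) = 1 + tr X + tr (adj X) + det X` for `X = B - 1`. -/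
theorem trace_adjugate_sub_one {R : Type*} [CommRing R] (B : Matrix (Fin 3) (Fin 3) R) :
    (B - 1).adjugate.trace + (B - 1).det = B.det - B.trace + 2 := by
  rw [Matrix.adjugate_fin_three, Matrix.det_fin_three, Matrix.det_fin_three]
  simp [Matrix.trace, Fin.sum_univ_three]
  ring

end Adjugate

/-! ### Cyclic block matrices -/

section CyclicBlock

variable {R : Type*} [CommRing R] {ι : Type*} [DecidableEq ι] {n : ℕ}

/-- The block matrix with rows `S k · e_k - e_{k+1}` for `k < n`, of index `k + 1`, and the row
`P · e_n + Q · e_0`, of index `0`. -/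
def cyclicBlock (S : Fin n → Matrix ι ι R) (P Q : Matrix ι ι R) :
    Matrix (Fin (n + 1) × ι) (Fin (n + 1) × ι) R :=
  fun x y => Fin.cases
    ((if y.1 = Fin.last n then P x.2 y.2 else 0) + if y.1 = 0 then Q x.2 y.2 else 0)
    (fun k => (if y.1 = k.castSucc then S k x.2 y.2 else 0) -
      if y.1 = k.succ then (1 : Matrix ι ι R) x.2 y.2 else 0) x.1

theorem cyclicBlock_zero (S : Fin n → Matrix ι ι R) (P Q : Matrix ι ι R) (i : ι)
    (y : Fin (n + 1) × ι) : cyclicBlock S P Q (0, i) y =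
      (if y.1 = Fin.last n then P i y.2 else 0) + if y.1 = 0 then Q i y.2 else 0 := rfl

theorem cyclicBlock_succ (S : Fin n → Matrix ι ι R) (P Q : Matrix ι ι R) (k : Fin n) (i : ι)
    (y : Fin (n + 1) × ι) : cyclicBlock S P Q (k.succ, i) y =
      (if y.1 = k.castSucc then S k i y.2 else 0) -
        if y.1 = k.succ then (1 : Matrix ι ι R) i y.2 else 0 := rfl

/-- A cofactor is the determinant after replacement of a row. At height `0` the replacement only
changes `P` and `Q`, so `associated_det_cyclicBlock` also computes cofactors. -/
theorem cyclicBlock_updateRow (S : Fin n → Matrix ι ι R) (P Q : Matrix ι ι R) (i j : ι) :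
    (cyclicBlock S P Q).updateRow (0, i) (Pi.single (0, j) 1) =
      cyclicBlock S (P.updateRow i 0) (Q.updateRow i (Pi.single j 1)) := by
  ext ⟨h, a⟩ ⟨h', b⟩
  refine Fin.cases ?_ (fun k => ?_) h
  · rw [cyclicBlock_zero]
    by_cases hai : a = i
    · subst hai
      simp [Pi.single_apply, Prod.ext_iff, ite_and]
    · rw [Matrix.updateRow_ne (by simpa using hai), cyclicBlock_zero, Matrix.updateRow_ne hai,
        Matrix.updateRow_ne hai]
  · rw [Matrix.updateRow_ne (by simp), cyclicBlock_succ, cyclicBlock_succ]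

/-- The determinant of a cyclic block matrix, up to a sign. -/
theorem associated_det_cyclicBlock [Fintype ι] [Nonempty ι] (S : Fin n → Matrix ι ι R) (P Q : Matrix ι ι R)
    (B : Fin (n + 1) → Matrix ι ι R) (hB0 : B 0 = 1)
    (hB : ∀ k : Fin n, B k.succ = S k * B k.castSucc) :
    Associated (cyclicBlock S P Q).det (P * B (Fin.last n) + Q).det := by
  classical
  -- The block column `B 0, …, B n` is killed by the rows of index `k + 1`. Multiplication by `1 +
  -- N` puts it in place of the block column `0`, where only the top block `P * B n + Q` survives.
  let N : Matrix (Fin (n + 1) × ι) (Fin (n + 1) × ι) R := fun x y =>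
    if y.1 = 0 ∧ x.1 ≠ 0 then B x.1 x.2 y.2 else 0
  have hNN : N * N = 0 := by
    ext x y
    rw [Matrix.mul_apply]
    refine Finset.sum_eq_zero fun z _ => ?_
    by_cases hz : z.1 = 0 <;> simp [N, hz]
  have hU : IsUnit (1 + N).det := by
    have h : (1 + N) * (1 - N) = 1 := by
      rw [add_mul, mul_sub, mul_sub, hNN]
      simp
    exact Matrix.isUnit_det_of_right_inverse h
  have hUapp : ∀ x y, (1 + N) x y = if y.1 = 0 then B x.1 x.2 y.2 else
      if x.1 = y.1 then (1 : Matrix ι ι R) x.2 y.2 else 0 := by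
    rintro ⟨h, i⟩ ⟨h', j⟩
    rw [Matrix.add_apply]
    by_cases h0 : h' = 0
    · subst h0
      by_cases h1 : h = 0
      · subst h1
        simp [N, hB0, Matrix.one_apply]
      · simp [N, h1]
    · simp [N, h0, Matrix.one_apply, Prod.ext_iff, ite_and]
  set M := cyclicBlock S P Q * (1 + N) with hM
  have hM0 : ∀ i j, M (0, i) (0, j) = (P * B (Fin.last n) + Q) i j := by
    intro i j
    rw [hM, Matrix.mul_apply, Fintype.sum_prod_type, Finset.sum_comm]
    simp only [cyclicBlock_zero, hUapp, if_true, add_mul, ite_mul, zero_mul,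
      Finset.sum_add_distrib, Finset.sum_ite_eq', Finset.mem_univ, hB0]
    simp [Matrix.mul_apply, Matrix.one_apply]
  have hM1 : ∀ k i j, M (Fin.succ k, i) (0, j) = 0 := by
    intro k i j
    rw [hM, Matrix.mul_apply, Fintype.sum_prod_type, Finset.sum_comm]
    simp only [cyclicBlock_succ, hUapp, if_true, sub_mul, ite_mul, zero_mul,
      Finset.sum_sub_distrib, Finset.sum_ite_eq', Finset.mem_univ, hB]
    simp [Matrix.mul_apply, Matrix.one_apply]
  have hM2 : ∀ x (k : Fin n) j, M x (k.succ, j) = cyclicBlock S P Q x (k.succ, j) := by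
    intro x k j
    rw [hM, Matrix.mul_apply, Fintype.sum_prod_type, Finset.sum_comm]
    simp only [hUapp, Fin.succ_ne_zero, if_false, mul_ite, mul_zero,
      Finset.sum_ite_eq', Finset.mem_univ, if_true]
    simp [Matrix.one_apply]
  -- Height `0` comes first, then the others in decreasing order: the row `k + 1` meets only the
  -- heights `k` and `k + 1`, and vanishes at height `0`, so `M` becomes upper triangular by blocks.
  let b : Fin (n + 1) × ι → ℕ := fun x => if x.1 = 0 then 0 else n + 1 - x.1
  have hbz : ∀ x, b x = 0 ↔ x.1 = 0 := by
    intro x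
    by_cases h0 : x.1 = 0
    · simp [b, h0]
    · simp only [b, h0, if_false, iff_false]
      have := x.1.2
      omega
  have hbs : ∀ (k : Fin n) i, b (k.succ, i) = n - k := by
    intro k i
    simp [b]
  have htri : M.BlockTriangular b := by
    rintro ⟨h, i⟩ ⟨h', j⟩ hlt
    revert hlt
    refine Fin.cases ?_ (fun k => ?_) h
    · intro hlt
      simp [b] at hlt
    · refine Fin.cases (fun _ => hM1 k i j) (fun k' => ?_) h'
      intro hlt
      rw [hbs, hbs] at hlt
      rw [hM2, cyclicBlock_succ, if_neg, if_neg, sub_zero]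
      · simp only [Fin.succ_inj]
        rintro rfl
        omega
      · intro hc
        have := congrArg Fin.val hc
        simp at this
        omega
  have hdet := htri.det
  have hassoc : Associated M.det (P * B (Fin.last n) + Q).det := by
    obtain ⟨i₀⟩ := ‹Nonempty ι›
    have h0mem : 0 ∈ Finset.univ.image b :=
      Finset.mem_image.mpr ⟨(0, i₀), Finset.mem_univ _, by simp [b]⟩
    let e : ι ≃ {x // b x = 0} :=
      { toFun := fun i => ⟨(0, i), by simp [b]⟩
        invFun := fun x => x.1.2
        left_inv := fun i => rfl
        right_inv := fun x => Subtype.ext (Prod.ext ((hbz x.1).mp x.2).symm rfl) }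
    have hblock : (M.toSquareBlock b 0).det = (P * B (Fin.last n) + Q).det := by
      rw [← Matrix.det_submatrix_equiv_self e]
      congr 1
      ext i j
      exact hM0 i j
    rw [hdet, ← Finset.mul_prod_erase _ _ h0mem, hblock]
    refine (associated_mul_unit_right _ _ ?_).symm
    refine Finset.prod_induction _ IsUnit (fun _ _ => IsUnit.mul) isUnit_one fun a ha => ?_
    have ha0 : a ≠ 0 := Finset.ne_of_mem_erase ha
    -- A non-zero level is a single height, and its diagonal block contributes only a sign.
    have hneg : M.toSquareBlock b a = -1 := by
      ext ⟨⟨h, i⟩, hx⟩ ⟨⟨h', j⟩, hy⟩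
      obtain ⟨k, rfl⟩ := Fin.exists_succ_eq.mpr fun h0 => ha0 (hx.symm.trans ((hbz _).mpr h0))
      obtain ⟨k', rfl⟩ := Fin.exists_succ_eq.mpr fun h0 => ha0 (hy.symm.trans ((hbz _).mpr h0))
      have hk : k' = k := by
        rw [hbs] at hx hy
        omega
      subst hk
      rw [Matrix.toSquareBlock_def, Matrix.of_apply, hM2, cyclicBlock_succ, if_neg, if_pos rfl]
      · simp [Matrix.one_apply]
      · intro hc
        have := congrArg Fin.val hc
        simp at this
    rw [hneg, Matrix.det_neg, Matrix.det_one, mul_one]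
    exact (isUnit_one.neg).pow _
  have h2 : M.det = (cyclicBlock S P Q).det * (1 + N).det := by rw [hM, Matrix.det_mul]
  rw [h2] at hassoc
  exact (associated_mul_unit_right _ _ hU).trans hassoc

end CyclicBlock

noncomputable section

namespace ModularBraid

open LaurentPolynomial (T)

/-! ### The Burau representation -/

section Burau

variable {R : Type*} [CommRing R]

/-- The matrix that expresses the segments above a letter of a braid word in terms of the segments
below, in the Alexander module; here `s` stands for the inverse of `t`. -/
def segmentMatrix (t s : R) : Fin 2 × Bool → Matrix (Fin 3) (Fin 3) R
  | (0, true) => !![1 - t, t, 0; 1, 0, 0; 0, 0, 1]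
  | (0, false) => !![0, 1, 0; s, 1 - s, 0; 0, 0, 1]
  | (1, true) => !![1, 0, 0; 0, 1 - t, t; 0, 1, 0]
  | (1, false) => !![1, 0, 0; 0, 0, 1; 0, s, 1 - s]

theorem segmentMatrix_mul_inv {t s : R} (h : t * s = 1) (i : Fin 2) :
    segmentMatrix t s (i, false) * segmentMatrix t s (i, true) = 1 := by
  fin_cases i <;> ext a b <;> fin_cases a <;> fin_cases b <;>
    simp [segmentMatrix, Matrix.mul_apply, Fin.sum_univ_three] <;>
    first | linear_combination h | linear_combination -h

/-- The generators of the Burau representation. -/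
def burauGen {t s : R} (h : t * s = 1) (i : Fin 2) : (Matrix (Fin 3) (Fin 3) R)ˣ where
  val := (segmentMatrix t s (i, true)).transpose
  inv := (segmentMatrix t s (i, false)).transpose
  val_inv := by
    rw [← Matrix.transpose_mul, segmentMatrix_mul_inv h, Matrix.transpose_one]
  inv_val := by
    rw [← Matrix.transpose_mul, mul_eq_one_comm.mp (segmentMatrix_mul_inv h i),
      Matrix.transpose_one]

/-- The (unreduced) Burau representation of `B₃`. -/
def burau {t s : R} (h : t * s = 1) : B₃ →* (Matrix (Fin 3) (Fin 3) R)ˣ :=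
  PresentedGroup.toGroup (f := burauGen h) (by
    rintro r rfl
    simp only [map_mul, map_inv, FreeGroup.lift_apply_of]
    rw [mul_inv_eq_one]
    ext a b
    fin_cases a <;> fin_cases b <;>
      simp [burauGen, segmentMatrix, Matrix.mul_apply, Fin.sum_univ_three] <;> ring)

theorem burau_toBraid {t s : R} (h : t * s = 1) (w : BraidWord) :
    (burau h w.toBraid).val = (w.map fun x => (segmentMatrix t s x).transpose).prod := by
  have h' : burau h w.toBraid = FreeGroup.lift (burauGen h) (FreeGroup.mk w) := rfl
  rw [h', FreeGroup.lift_mk, ← Units.coeHom_apply, map_list_prod, List.map_map]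
  congr 1
  refine List.map_congr_left fun x _ => ?_
  obtain ⟨i, _ | _⟩ := x <;> rfl

/-- The product of the segment matrices of a braid word: it expresses the segments at the top in
terms of the segments at the bottom. -/
def segmentProd (t s : R) (w : BraidWord) : Matrix (Fin 3) (Fin 3) R :=
  (w.map fun x => (segmentMatrix t s x).transpose).prod.transpose

theorem segmentProd_nil (t s : R) : segmentProd t s [] = 1 := by simp [segmentProd]

theorem segmentProd_append_singleton (t s : R) (w : BraidWord) (x : Fin 2 × Bool) :
    segmentProd t s (w ++ [x]) = segmentMatrix t s x * segmentProd t s w := by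
  simp [segmentProd]

/-- Up to transposition, `segmentProd` is the value of the Burau representation, whose trace and
determinant are class functions. -/
theorem trace_det_segmentProd_eq {t s : R} (hts : t * s = 1) {w w' : BraidWord}
    (h : IsConj w.toBraid w'.toBraid) :
    (segmentProd t s w).trace = (segmentProd t s w').trace ∧
      (segmentProd t s w).det = (segmentProd t s w').det := by
  obtain ⟨c, hc⟩ := isConj_iff.mp h
  have hval : (burau hts w'.toBraid).val = (burau hts c).val * (burau hts w.toBraid).val *
      ((burau hts c)⁻¹).val := by
    rw [← hc, map_mul, map_mul, map_inv, Units.val_mul, Units.val_mul]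
  simp only [segmentProd, Matrix.trace_transpose, Matrix.det_transpose, ← burau_toBraid hts]
  rw [hval]
  constructor
  · rw [Matrix.trace_mul_comm, ← mul_assoc, ← Units.val_mul]
    simp
  · rw [Matrix.det_mul, Matrix.det_mul, mul_right_comm, ← Matrix.det_mul, ← Units.val_mul]
    simp

/-- The constant colouring of the segments satisfies the relations at every crossing. -/
theorem segmentMatrix_mulVec_one (t s : R) (x : Fin 2 × Bool) :
    (segmentMatrix t s x).mulVec 1 = 1 := by
  obtain ⟨i, b⟩ := x
  fin_cases i <;> cases b <;> funext a <;> fin_cases a <;>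
    simp [segmentMatrix, Matrix.mulVec, dotProduct, Fin.sum_univ_three]

/-- The vector `(1, t, t²)` consists of the abelianised Fox derivatives of the product of the three
meridians, which a braid preserves. -/
theorem vecMul_segmentMatrix {t s : R} (h : t * s = 1) (x : Fin 2 × Bool) :
    Matrix.vecMul (fun i : Fin 3 => t ^ (i : ℕ)) (segmentMatrix t s x) =
      fun i : Fin 3 => t ^ (i : ℕ) := by
  obtain ⟨i, b⟩ := x
  fin_cases i <;> cases b <;> funext a <;> fin_cases a <;>
    simp [segmentMatrix, Matrix.vecMul, dotProduct, Fin.sum_univ_three] <;>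
    first | ring1 | linear_combination h | linear_combination t * h |
      linear_combination -h | linear_combination -t * h

theorem segmentProd_mulVec_one (t s : R) (w : BraidWord) : (segmentProd t s w).mulVec 1 = 1 := by
  induction w using List.reverseRecOn with
  | nil => simp [segmentProd_nil]
  | append_singleton w x ih =>
    rw [segmentProd_append_singleton, ← Matrix.mulVec_mulVec, ih, segmentMatrix_mulVec_one]

theorem vecMul_segmentProd {t s : R} (h : t * s = 1) (w : BraidWord) :
    Matrix.vecMul (fun i : Fin 3 => t ^ (i : ℕ)) (segmentProd t s w) =
      fun i : Fin 3 => t ^ (i : ℕ) := by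
  induction w using List.reverseRecOn with
  | nil => simp [segmentProd_nil]
  | append_singleton w x ih =>
    rw [segmentProd_append_singleton, ← Matrix.vecMul_vecMul, vecMul_segmentMatrix h, ih]

/-- The first minor of `B - 1`, for a Burau matrix `B`, in terms of its trace and determinant. -/
theorem adjugate_segmentProd_sub_one [IsDomain R] {t s : R} (hts : t * s = 1) (w : BraidWord) :
    (segmentProd t s w - 1).adjugate 0 0 * (1 + t + t ^ 2) =
      (segmentProd t s w).det - (segmentProd t s w).trace + 2 := by
  have h1 : (segmentProd t s w - 1).mulVec 1 = 0 := by
    rw [Matrix.sub_mulVec, segmentProd_mulVec_one, Matrix.one_mulVec, sub_self]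
  have h2 : Matrix.vecMul (fun i : Fin 3 => t ^ (i : ℕ)) (segmentProd t s w - 1) = 0 := by
    rw [Matrix.vecMul_sub, vecMul_segmentProd hts, Matrix.vecMul_one, sub_self]
  have hdet : (segmentProd t s w - 1).det = 0 :=
    Matrix.exists_mulVec_eq_zero_iff.mp ⟨1, one_ne_zero, h1⟩
  have hadj : ∀ i : Fin 3, (segmentProd t s w - 1).adjugate i i =
      (segmentProd t s w - 1).adjugate 0 0 * t ^ (i : ℕ) := by
    intro i
    have h := adjugate_mul_eq_of_vecMul_eq_zero h2 i i 0
    rw [adjugate_eq_of_mulVec_one_eq_zero h1 i 0 0] at h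
    simpa using h
  have h3 := trace_adjugate_sub_one (segmentProd t s w)
  rw [hdet, add_zero, Matrix.trace, Fin.sum_univ_three, Matrix.diag_apply, Matrix.diag_apply,
    Matrix.diag_apply, hadj 1, hadj 2] at h3
  rw [← h3]
  simp
  ring

/-- The Alexander matrix of the closure of a braid word. -/
def alexanderMatrix (t s : R) (w : BraidWord) :
    Matrix (Fin (w.length + 1) × Fin 3) (Fin (w.length + 1) × Fin 3) R :=
  cyclicBlock (fun k => segmentMatrix t s (w.get k)) 1 (-1)

theorem alexanderMatrix_mulVec_one (t s : R) (w : BraidWord) :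
    (alexanderMatrix t s w).mulVec 1 = 0 := by
  funext ⟨h, i⟩
  simp only [alexanderMatrix, Matrix.mulVec, dotProduct, Pi.one_apply, mul_one, Pi.zero_apply,
    Fintype.sum_prod_type]
  rw [Finset.sum_comm]
  refine Fin.cases ?_ (fun k => ?_) h
  · simp [cyclicBlock_zero, Finset.sum_add_distrib, Matrix.one_apply]
  · have hS := congrFun (segmentMatrix_mulVec_one t s (w.get k)) i
    simp only [Matrix.mulVec, dotProduct, Pi.one_apply, mul_one] at hS
    simp only [cyclicBlock_succ, Finset.sum_sub_distrib, Finset.sum_ite_eq', Finset.mem_univ,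
      if_true, hS]
    simp [Matrix.one_apply]

theorem vecMul_alexanderMatrix {t s : R} (hts : t * s = 1) (w : BraidWord) :
    Matrix.vecMul (fun x => t ^ (x.2 : ℕ)) (alexanderMatrix t s w) = 0 := by
  funext ⟨h, j⟩
  simp only [alexanderMatrix, Matrix.vecMul, dotProduct, Pi.zero_apply, Fintype.sum_prod_type]
  have hS : ∀ k, ∑ i : Fin 3, t ^ (i : ℕ) * segmentMatrix t s (w.get k) i j = t ^ (j : ℕ) :=
    fun k => congrFun (vecMul_segmentMatrix hts (w.get k)) j
  have h0 : ∑ i : Fin 3, t ^ (i : ℕ) *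
      cyclicBlock (fun k => segmentMatrix t s (w.get k)) 1 (-1) (0, i) (h, j) =
      (if h = Fin.last _ then t ^ (j : ℕ) else 0) - if h = 0 then t ^ (j : ℕ) else 0 := by
    simp only [cyclicBlock_zero, mul_add, Finset.sum_add_distrib, sub_eq_add_neg]
    congr 1 <;> split_ifs <;> simp [Matrix.one_apply]
  have h1 : ∀ k : Fin w.length, ∑ i : Fin 3, t ^ (i : ℕ) *
      cyclicBlock (fun k => segmentMatrix t s (w.get k)) 1 (-1) (k.succ, i) (h, j) =
      (if h = k.castSucc then t ^ (j : ℕ) else 0) - if h = k.succ then t ^ (j : ℕ) else 0 := by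
    intro k
    simp only [cyclicBlock_succ, mul_sub, Finset.sum_sub_distrib]
    congr 1
    · split_ifs
      · exact hS k
      · simp
    · split_ifs <;> simp [Matrix.one_apply]
  rw [Fin.sum_univ_succ, h0, Finset.sum_congr rfl fun k _ => h1 k, Finset.sum_sub_distrib]
  -- Each height is the upper end of one block row and the lower end of another, with the closing
  -- joints from `n` to `0`; the two contributions cancel.
  have e1 := Fin.sum_univ_succ fun k : Fin (w.length + 1) => if h = k then t ^ (j : ℕ) else 0
  have e2 := Fin.sum_univ_castSucc fun k : Fin (w.length + 1) => if h = k then t ^ (j : ℕ) else 0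
  linear_combination e1 - e2

/-- The elimination has the partial products of the word as blocks `B k`. The result is `segmentProd
- 1` with its first row replaced by the first basis vector. -/
theorem associated_adjugate_alexanderMatrix (t s : R) (w : BraidWord) :
    Associated ((alexanderMatrix t s w).adjugate (0, 0) (0, 0))
      ((segmentProd t s w - 1).adjugate 0 0) := by
  rw [Matrix.adjugate_apply, Matrix.adjugate_apply, alexanderMatrix, cyclicBlock_updateRow]
  have h := associated_det_cyclicBlock (fun k => segmentMatrix t s (w.get k))
    ((1 : Matrix (Fin 3) (Fin 3) R).updateRow 0 0)
    ((-1 : Matrix (Fin 3) (Fin 3) R).updateRow 0 (Pi.single 0 1))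
    (fun k => segmentProd t s (w.take k)) (by simp [segmentProd_nil]) (by
      intro k
      rw [← segmentProd_append_singleton]
      simp)
  convert h using 2
  ext a b
  by_cases ha : a = 0
  · subst ha
    simp [Matrix.mul_apply]
  · simp [Matrix.updateRow_ne ha, Matrix.mul_apply, sub_eq_add_neg, Matrix.one_apply]

theorem segmentMatrix_map {R' : Type*} [CommRing R'] (f : R →+* R') (t s : R) (x : Fin 2 × Bool) :
    (segmentMatrix t s x).map f = segmentMatrix (f t) (f s) x := by
  obtain ⟨i, b⟩ := x
  fin_cases i <;> cases b <;> ext a b <;> fin_cases a <;> fin_cases b <;> simp [segmentMatrix]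

theorem segmentProd_map {R' : Type*} [CommRing R'] (f : R →+* R') (t s : R) (w : BraidWord) :
    (segmentProd t s w).map f = segmentProd (f t) (f s) w := by
  induction w using List.reverseRecOn with
  | nil => simp [segmentProd_nil]
  | append_singleton w x ih =>
    rw [segmentProd_append_singleton, segmentProd_append_singleton, Matrix.map_mul, ih,
      segmentMatrix_map]

end Burau

/-! ### The Alexander ideal of the closure of a braid -/

theorem T_one_mul_T_neg_one : (T 1 * T (-1) : ℤ[T;T⁻¹]) = 1 := by
  rw [← LaurentPolynomial.T_add]
  simp

/-- Each of the three upper segments is the outgoing segment of exactly one relation, which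
expresses it in terms of the lower ones. -/
theorem rows_braidLetterVertices {H : Type} [DecidableEq H] (a b : H) (x : Fin 2 × Bool) :
    ⋃ v ∈ braidLetterVertices a b x, v.rows = Set.range fun i : Fin 3 =>
      (∑ j, segmentMatrix (R := ℤ[T;T⁻¹]) (T 1) (T (-1)) x i j • Pi.single (a, j) 1) - Pi.single (b, i) 1 := by
  have hrange : ∀ f : Fin 3 → H × Fin 3 → ℤ[T;T⁻¹], Set.range f = {f 0, f 1, f 2} := by
    intro f
    ext y
    simp [Fin.exists_fin_succ, eq_comm]
  have h0 : {v | ∃ k : Fin 3, k ≠ (0 : Fin 2).castSucc ∧ k ≠ (0 : Fin 2).succ ∧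
      v = Vertex.joint (a, k) (b, k)} = {Vertex.joint (a, 2) (b, 2)} := by
    ext v
    simp [Fin.exists_fin_succ]
  have h1 : {v | ∃ k : Fin 3, k ≠ (1 : Fin 2).castSucc ∧ k ≠ (1 : Fin 2).succ ∧
      v = Vertex.joint (a, k) (b, k)} = {Vertex.joint (a, 0) (b, 0)} := by
    ext v
    simp [Fin.exists_fin_succ]
  rw [hrange]
  obtain ⟨i, c⟩ := x
  fin_cases i <;> cases c
  · simp only [Fin.zero_eta, braidLetterVertices, h0]
    ext y
    simp [Vertex.rows, segmentMatrix, Fin.sum_univ_three, crossingVar]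
    tauto
  · simp only [Fin.zero_eta, braidLetterVertices, h0]
    ext y
    simp [Vertex.rows, segmentMatrix, Fin.sum_univ_three, crossingVar]
    rw [add_comm (T 1 • _)]
    tauto
  · simp only [Fin.mk_one, braidLetterVertices, h1]
    ext y
    simp [Vertex.rows, segmentMatrix, Fin.sum_univ_three, crossingVar]
  · simp only [Fin.mk_one, braidLetterVertices, h1]
    ext y
    simp [Vertex.rows, segmentMatrix, Fin.sum_univ_three, crossingVar]
    rw [add_comm (T 1 • _)]
    tauto

theorem rows_closure (w : BraidWord) :
    (closure w).rows = Set.range (alexanderMatrix (T 1) (T (-1)) w) := by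
  have h0 : ∀ i, alexanderMatrix (R := ℤ[T;T⁻¹]) (T 1) (T (-1)) w (0, i) =
      Pi.single (Fin.last w.length, i) 1 - Pi.single (0, i) 1 := by
    intro i
    funext ⟨h, j⟩
    rw [alexanderMatrix, cyclicBlock_zero, Pi.sub_apply, Pi.single_apply, Pi.single_apply,
      sub_eq_add_neg]
    congr 1
    · simp [Matrix.one_apply, Prod.ext_iff, ite_and, eq_comm]
    · simp [Matrix.one_apply, Prod.ext_iff, ite_and, eq_comm, neg_ite]
  have h1 : ∀ k i, alexanderMatrix (R := ℤ[T;T⁻¹]) (T 1) (T (-1)) w (Fin.succ k, i) =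
      (∑ j, segmentMatrix (R := ℤ[T;T⁻¹]) (T 1) (T (-1)) (w.get k) i j •
        Pi.single (k.castSucc, j) 1) - Pi.single (k.succ, i) 1 := by
    intro k i
    funext ⟨h, j⟩
    rw [alexanderMatrix, cyclicBlock_succ, Pi.sub_apply, Finset.sum_apply]
    congr 1
    · simp only [Pi.smul_apply, Pi.single_apply, Prod.mk.injEq, smul_eq_mul, mul_ite, mul_one,
        mul_zero, ite_and]
      split_ifs <;> simp
    · simp [Matrix.one_apply, Pi.single_apply, ite_and, eq_comm]
  have hrows : (closure w).rows =
      (⋃ k : Fin w.length, ⋃ v ∈ braidLetterVertices k.castSucc k.succ (w.get k), v.rows) ∪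
        ⋃ i : Fin 3, (Vertex.joint (Fin.last w.length, i) (0, i)).rows := by
    refine (Set.biUnion_union _ _ _).trans ?_
    exact congrArg₂ _ (Set.biUnion_iUnion _ _) Set.biUnion_range
  rw [hrows]
  ext y
  simp only [rows_braidLetterVertices, ← h1, Set.mem_union, Set.mem_iUnion]
  constructor
  · rintro (⟨k, i, rfl⟩ | ⟨i, rfl⟩)
    · exact ⟨(k.succ, i), rfl⟩
    · exact ⟨(0, i), h0 i⟩
  · rintro ⟨⟨h, i⟩, rfl⟩
    refine Fin.cases ?_ (fun k => ?_) h
    · exact Or.inr ⟨i, h0 i⟩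
    · exact Or.inl ⟨k, i, rfl⟩

/-- The row relation with weights `t^i` has coefficient `1` at position `0`, so one cofactor
generates all the others. -/
theorem alexanderIdeal_closure (w : BraidWord) :
    (closure w).alexanderIdeal =
      Ideal.span {(segmentProd (R := ℤ[T;T⁻¹]) (T 1) (T (-1)) w - 1).adjugate 0 0} := by
  have h1 : (closure w).alexanderIdeal = Ideal.span
      (Set.range fun p : (Fin (w.length + 1) × Fin 3) × (Fin (w.length + 1) × Fin 3) =>
        (alexanderMatrix (T 1) (T (-1)) w).adjugate p.1 p.2) := by
    rw [← span_minors_eq_span_adjugate, Diagram.alexanderIdeal, rows_closure]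
    rfl
  rw [h1, span_adjugate_eq_span_singleton (alexanderMatrix_mulVec_one _ _ w)
    (vecMul_alexanderMatrix T_one_mul_T_neg_one w) (i := (0, 0)) (j := (0, 0)) (pow_zero _),
    Ideal.span_singleton_eq_span_singleton]
  exact associated_adjugate_alexanderMatrix _ _ w

theorem isAlexanderPolynomial_closure_iff (w : BraidWord) (P : ℤ[T;T⁻¹]) :
    (closure w).IsAlexanderPolynomial P ↔
      Associated P ((segmentProd (R := ℤ[T;T⁻¹]) (T 1) (T (-1)) w - 1).adjugate 0 0) := by
  simp only [Diagram.IsAlexanderPolynomial, alexanderIdeal_closure,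
    Ideal.span_singleton_le_span_singleton]
  constructor
  · rintro ⟨h1, h2⟩
    exact associated_of_dvd_dvd h1 (h2 _ dvd_rfl)
  · intro h
    exact ⟨h.dvd, fun Q hQ => hQ.trans h.symm.dvd⟩

end ModularBraid

end

noncomputable section

namespace ModularBraid

open LaurentPolynomial (T)

/-! ### The Burau representation on `SL₂(ℕ)` at `t = -q²` -/

section Deformation

variable {R : Type*} [CommRing R]

/-- The matrices `L_q` and `R_q` over an arbitrary ring; here `p` stands for the inverse of `q`. -/
def Letter.deformedAt (q p : R) : Letter → Matrix (Fin 2) (Fin 2) R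
  | .L => !![q, 0; 1, p]
  | .R => !![q, 1; 0, p]

/-- The scalars `q⁻¹` for `L`, and `q` for `R`. -/
def Letter.scaleAt (q p : R) : Letter → R
  | .L => p
  | .R => q

/-- A basis in which the Burau representation is block triangular. -/
def burauBasis (q : R) : Matrix (Fin 3) (Fin 3) R := !![0, 1, 0; -q, -1, 0; q, 0, 1]

/-- The first two columns of `burauBasis` span the plane of vectors with coordinate sum zero. The
transposed segment matrices preserve the coordinate sum by `segmentMatrix_mulVec_one`; it is the
last row of the inverse, whence the row `0, 0, 1` of the triangular form. -/
theorem burauBasis_inv_mul {q p : R} (h : q * p = 1) :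
    (!![-p, -p, 0; 1, 0, 0; 1, 1, 1] : Matrix (Fin 3) (Fin 3) R) * burauBasis q = 1 := by
  ext a b
  fin_cases a <;> fin_cases b <;> simp [burauBasis, Matrix.mul_apply, Fin.sum_univ_three]
  linear_combination h

/-- In the basis `burauBasis`, a letter acts with the blocks `q^{±1} x_q` and `1`. -/
theorem segmentMatrix_transpose_mul_burauBasis {q p : R} (h : q * p = 1) (x : Letter) :
    ∃ a b, (segmentMatrix (-q ^ 2) (-p ^ 2) x.toBraidLetter).transpose * burauBasis q =
      burauBasis q *
        !![x.scaleAt q p * x.deformedAt q p 0 0, x.scaleAt q p * x.deformedAt q p 0 1, a;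
          x.scaleAt q p * x.deformedAt q p 1 0, x.scaleAt q p * x.deformedAt q p 1 1, b;
          0, 0, 1] := by
  have hL : q * p ^ 2 = p := by linear_combination p * h
  cases x
  · refine ⟨0, 0, ?_⟩
    ext i j
    fin_cases i <;> fin_cases j <;> simp [burauBasis, Matrix.mul_apply, Fin.sum_univ_three,
      segmentMatrix, Letter.toBraidLetter, Letter.scaleAt, Letter.deformedAt] <;>
      first | ring1 | linear_combination h | linear_combination hL | linear_combination -hL |
        linear_combination q * h - hL | linear_combination -q * h
  -- For `R`, the third basis vector `e₃` goes to `e₂`, which is `e₃` minus `p` times the first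
  -- basis vector; for `L` it is fixed.
  · refine ⟨-p, 0, ?_⟩
    ext i j
    fin_cases i <;> fin_cases j <;> simp [burauBasis, Matrix.mul_apply, Fin.sum_univ_three,
      segmentMatrix, Letter.toBraidLetter, Letter.scaleAt, Letter.deformedAt] <;>
      first | ring1 | linear_combination h | linear_combination -h

theorem det_prod_deformedAt {q p : R} (h : q * p = 1) (v : List Letter) :
    ((v.map (Letter.deformedAt q p)).prod).det = 1 := by
  induction v with
  | nil => simp
  | cons x v ih =>
    rw [List.map_cons, List.prod_cons, Matrix.det_mul, ih, mul_one]
    cases x <;> simp [Letter.deformedAt, Matrix.det_fin_two, h]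

theorem prod_segmentMatrix_transpose_mul_burauBasis {q p : R} (h : q * p = 1) (v : List Letter) :
    ∃ a b, ((v.map Letter.toBraidLetter).map
        fun x => (segmentMatrix (-q ^ 2) (-p ^ 2) x).transpose).prod * burauBasis q =
      burauBasis q *
        !![(v.map (Letter.scaleAt q p)).prod * (v.map (Letter.deformedAt q p)).prod 0 0,
          (v.map (Letter.scaleAt q p)).prod * (v.map (Letter.deformedAt q p)).prod 0 1, a;
          (v.map (Letter.scaleAt q p)).prod * (v.map (Letter.deformedAt q p)).prod 1 0,
          (v.map (Letter.scaleAt q p)).prod * (v.map (Letter.deformedAt q p)).prod 1 1, b;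
          0, 0, 1] := by
  induction v with
  | nil =>
    refine ⟨0, 0, ?_⟩
    have h1 : (!![1, 0, 0; 0, 1, 0; 0, 0, 1] : Matrix (Fin 3) (Fin 3) R) = 1 := by
      ext i j
      fin_cases i <;> fin_cases j <;> simp
    simp [h1]
  | cons x v ih =>
    obtain ⟨a, b, hv⟩ := ih
    obtain ⟨c, d, hx⟩ := segmentMatrix_transpose_mul_burauBasis h x
    simp only [List.map_cons, List.prod_cons]
    rw [mul_assoc, hv, ← mul_assoc, hx, mul_assoc]
    refine ⟨x.scaleAt q p * x.deformedAt q p 0 0 * a + x.scaleAt q p * x.deformedAt q p 0 1 * b + c,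
      x.scaleAt q p * x.deformedAt q p 1 0 * a + x.scaleAt q p * x.deformedAt q p 1 1 * b + d, ?_⟩
    congr 1
    ext i j
    fin_cases i <;> fin_cases j <;>
      simp [Matrix.mul_apply, Fin.sum_univ_three, Fin.sum_univ_two] <;> ring

/-- The trace and the determinant of the Burau matrix of a positive word in `L` and `R`. -/
theorem trace_det_segmentProd_map_toBraidLetter {q p : R} (h : q * p = 1) (v : List Letter) :
    (segmentProd (-q ^ 2) (-p ^ 2) (v.map Letter.toBraidLetter)).trace =
      (v.map (Letter.scaleAt q p)).prod * (v.map (Letter.deformedAt q p)).prod.trace + 1 ∧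
    (segmentProd (-q ^ 2) (-p ^ 2) (v.map Letter.toBraidLetter)).det =
      (v.map (Letter.scaleAt q p)).prod ^ 2 := by
  obtain ⟨a, b, hab⟩ := prod_segmentMatrix_transpose_mul_burauBasis h v
  have hinv := burauBasis_inv_mul h
  have hinv' := mul_eq_one_comm.mp hinv
  rw [segmentProd, Matrix.trace_transpose, Matrix.det_transpose]
  have hd := det_prod_deformedAt h v
  rw [Matrix.det_fin_two] at hd
  generalize (v.map (Letter.deformedAt q p)).prod = M at *
  generalize (v.map (Letter.scaleAt q p)).prod = k at *
  have e := congrArg (· * !![-p, -p, 0; 1, 0, 0; 1, 1, 1]) hab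
  simp only [mul_assoc, hinv', mul_one] at e
  rw [e]
  constructor
  · rw [Matrix.trace_mul_comm, mul_assoc, hinv, mul_one, Matrix.trace_fin_three,
      Matrix.trace_fin_two]
    simp
    ring
  · rw [Matrix.det_mul_comm, mul_assoc, hinv, mul_one, Matrix.det_fin_three]
    simp
    linear_combination k ^ 2 * hd

end Deformation

/-! ### The Alexander polynomial at `t = -q²` -/

theorem prod_scaleAt_T (v : List Letter) :
    (v.map (Letter.scaleAt (R := ℤ[T;T⁻¹]) (T 1) (T (-1)))).prod =
      T (v.map Letter.sign).sum := by
  induction v with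
  | nil => simp
  | cons x v ih =>
    rw [List.map_cons, List.prod_cons, ih, List.map_cons, List.sum_cons,
      LaurentPolynomial.T_add]
    cases x <;> rfl

theorem deformedAt_T : Letter.deformedAt (R := ℤ[T;T⁻¹]) (T 1) (T (-1)) = Letter.deformed := by
  funext x
  cases x <;> rfl

theorem substNegSq_T_one : substNegSq (T 1) = -T 1 ^ 2 := by
  rw [LaurentPolynomial.T_pow]
  simp [substNegSq, negSq]

theorem substNegSq_T_neg_one : substNegSq (T (-1)) = -T (-1) ^ 2 := by
  rw [LaurentPolynomial.T_pow]
  simp [substNegSq, negSq]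

theorem associated_substNegSq_alexander (A : SL2N) (w : BraidWord)
    (hw : IsConj w.toBraid (sigma A)) {P : ℤ[T;T⁻¹]}
    (hP : (closure w).IsAlexanderPolynomial P) :
    Associated (substNegSq P * (T 2 - 1 + T (-2)))
      (T (Rad A) - (deform A).trace + T (-Rad A)) := by
  rw [isAlexanderPolynomial_closure_iff] at hP
  have h1 := (hP.map substNegSq).mul_right (T 2 - 1 + T (-2))
  refine h1.trans ?_
  set c := (segmentProd (R := ℤ[T;T⁻¹]) (T 1) (T (-1)) w - 1).adjugate 0 0 with hc
  have h2 := congrArg substNegSq (adjugate_segmentProd_sub_one T_one_mul_T_neg_one w)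
  obtain ⟨ht, hd⟩ := trace_det_segmentProd_eq T_one_mul_T_neg_one (w' := sigmaWord A) hw
  have hmap := segmentProd_map substNegSq (T 1) (T (-1)) (sigmaWord A)
  rw [substNegSq_T_one, substNegSq_T_neg_one] at hmap
  obtain ⟨ht', hd'⟩ := trace_det_segmentProd_map_toBraidLetter T_one_mul_T_neg_one (word A)
  rw [prod_scaleAt_T, deformedAt_T] at ht'
  rw [prod_scaleAt_T] at hd'
  have et : substNegSq (segmentProd (T 1) (T (-1)) (sigmaWord A)).trace =
      T (Rad A) * (deform A).trace + 1 := by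
    rw [AddMonoidHom.map_trace]
    exact (congrArg Matrix.trace hmap).trans ht'
  have ed : substNegSq (segmentProd (T 1) (T (-1)) (sigmaWord A)).det = T (Rad A) ^ 2 := by
    rw [RingHom.map_det]
    exact (congrArg Matrix.det hmap).trans hd'
  rw [← hc, ht, hd] at h2
  simp only [map_mul, map_add, map_sub, map_one, map_pow, et, ed, substNegSq_T_one,
    map_ofNat] at h2
  have e1 : (T 2 : ℤ[T;T⁻¹]) = T 1 ^ 2 := by simp [LaurentPolynomial.T_pow]
  have e2 : (T 2 * T (-2) : ℤ[T;T⁻¹]) = 1 := by rw [← LaurentPolynomial.T_add]; simp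
  have e3 : (T (Rad A) * T (-Rad A) : ℤ[T;T⁻¹]) = 1 := by rw [← LaurentPolynomial.T_add]; simp
  -- The trace formula reads `c (1 - q² + q⁴) = q^{2 Rad} - q^{Rad} Tr(A_q) + 1`; the units `q²` and
  -- `q^{Rad}` are factored out to make both sides symmetric.
  have key : substNegSq c * (T 2 - 1 + T (-2)) * T 2 =
      (T (Rad A) - (deform A).trace + T (-Rad A)) * T (Rad A) := by
    rw [← e1] at h2
    linear_combination h2 + substNegSq c * e2 - e3
  have hu : ∀ n : ℤ, IsUnit (T n : ℤ[T;T⁻¹]) := LaurentPolynomial.isUnit_T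
  refine (associated_mul_unit_right _ _ (hu 2)).trans ?_
  rw [key]
  exact (associated_mul_unit_right _ _ (hu _)).symm

theorem exists_isAlexanderPolynomial_closure (w : BraidWord) :
    ∃ P, (closure w).IsAlexanderPolynomial P :=
  ⟨_, (isAlexanderPolynomial_closure_iff w _).mpr (Associated.refl _)⟩

end ModularBraid

end

noncomputable section

namespace ModularBraid

/-! ### Homotopies of loops in the unit tangent bundle -/

/-- The inclusion of `SL₂(ℤ)` in `SL₂(ℝ)`. -/
abbrev toReal : SL(2, ℤ) →* SL(2, ℝ) := Matrix.SpecialLinearGroup.map (Int.castRingHom ℝ)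

theorem toReal_apply (A : SL(2, ℤ)) (i j : Fin 2) : toReal A i j = (A i j : ℝ) := rfl

theorem det_eq_real (g : SL(2, ℝ)) : g 0 0 * g 1 1 - g 0 1 * g 1 0 = 1 := by
  have h := g.det_coe
  rwa [Matrix.det_fin_two] at h

theorem ext_entries_real {g h : SL(2, ℝ)} (h00 : g 0 0 = h 0 0) (h01 : g 0 1 = h 0 1)
    (h10 : g 1 0 = h 1 0) (h11 : g 1 1 = h 1 1) : g = h := by
  ext i j
  fin_cases i <;> fin_cases j <;> assumption

theorem mul_apply_real (g h : SL(2, ℝ)) (i j : Fin 2) :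
    (g * h) i j = g i 0 * h 0 j + g i 1 * h 1 j := by
  rw [Matrix.SpecialLinearGroup.coe_mul, Matrix.mul_apply, Fin.sum_univ_two]

theorem continuous_entry (i j : Fin 2) : Continuous fun g : SL(2, ℝ) => g i j :=
  (continuous_apply_apply i j).comp continuous_subtype_val

/-- A homotopy of paths in `SL₂(ℝ)`, with end points related by `A ∈ SL₂(ℤ)`, projects to a free
homotopy of loops. -/
theorem freelyHomotopic_of_lift (A : SL(2, ℤ)) {H : I × I → SL(2, ℝ)} (hH : Continuous H)
    (hA : ∀ t, H (t, 1) = toReal A * H (t, 0)) {γ₀ γ₁ : C(I, UnitTangent)}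
    (h₀ : ∀ s, γ₀ s = proj (H (0, s))) (h₁ : ∀ s, γ₁ s = proj (H (1, s))) :
    FreelyHomotopic γ₀ γ₁ :=
  ⟨{ toFun := fun p => proj (H p)
     continuous_toFun := continuous_proj.comp hH
     map_zero_left := fun s => (h₀ s).symm
     map_one_left := fun s => (h₁ s).symm
     prop' := fun t => by
      change proj (H (t, 0)) = proj (H (t, 1))
      rw [hA, proj_mul] }⟩

/-- The matrices of `SL₂(ℝ)` whose first entry is positive. -/
abbrev PosCorner : Type := {g : SL(2, ℝ) // 0 < g 0 0}

/-- The entries other than the last are coordinates on `PosCorner`; this is the segment between two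
points in these coordinates. -/
def cornerSegment (p : PosCorner × PosCorner × I) : SL(2, ℝ) :=
  ⟨!![(1 - p.2.2) * p.1.1 0 0 + p.2.2 * p.2.1.1 0 0, (1 - p.2.2) * p.1.1 0 1 + p.2.2 * p.2.1.1 0 1;
      (1 - p.2.2) * p.1.1 1 0 + p.2.2 * p.2.1.1 1 0,
      (1 + ((1 - p.2.2) * p.1.1 0 1 + p.2.2 * p.2.1.1 0 1) *
        ((1 - p.2.2) * p.1.1 1 0 + p.2.2 * p.2.1.1 1 0)) /
        ((1 - p.2.2) * p.1.1 0 0 + p.2.2 * p.2.1.1 0 0)], by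
    have h := (convex_Ioi (0 : ℝ)) p.1.2 p.2.1.2 (sub_nonneg.mpr p.2.2.2.2) p.2.2.2.1
      (sub_add_cancel _ _)
    have h' : (1 - (p.2.2 : ℝ)) * p.1.1 0 0 + p.2.2 * p.2.1.1 0 0 ≠ 0 := ne_of_gt h
    rw [Matrix.det_fin_two_of]
    field_simp
    ring⟩

theorem continuous_cornerSegment : Continuous cornerSegment := by
  have hc : ∀ i j, Continuous fun g : PosCorner => g.1 i j := fun i j =>
    (continuous_entry i j).comp continuous_subtype_val
  have h0 : ∀ i j, Continuous fun p : PosCorner × PosCorner × I =>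
      (1 - (p.2.2 : ℝ)) * p.1.1 i j + p.2.2 * p.2.1.1 i j := by
    intro i j
    have h1 : Continuous fun p : PosCorner × PosCorner × I => p.1.1 i j :=
      (hc i j).comp continuous_fst
    have h2 : Continuous fun p : PosCorner × PosCorner × I => p.2.1.1 i j :=
      (hc i j).comp (continuous_fst.comp continuous_snd)
    fun_prop
  refine Continuous.subtype_mk (continuous_matrix ?_) _
  intro i j
  fin_cases i <;> fin_cases j
  · exact h0 0 0
  · exact h0 0 1
  · exact h0 1 0
  · refine Continuous.div (continuous_const.add ((h0 0 1).mul (h0 1 0))) (h0 0 0) fun p => ?_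
    exact ne_of_gt ((convex_Ioi (0 : ℝ)) p.1.2 p.2.1.2 (sub_nonneg.mpr p.2.2.2.2) p.2.2.2.1
      (sub_add_cancel _ _))

theorem eq_div_of_posCorner (g : PosCorner) :
    (1 + g.1 0 1 * g.1 1 0) / g.1 0 0 = g.1 1 1 := by
  rw [div_eq_iff (ne_of_gt g.2)]
  linarith [det_eq_real g.1]

theorem cornerSegment_zero (g h : PosCorner) : cornerSegment (g, h, 0) = g := by
  refine ext_entries_real ?_ ?_ ?_ ?_ <;> simp [cornerSegment, eq_div_of_posCorner]

theorem cornerSegment_one (g h : PosCorner) : cornerSegment (g, h, 1) = h := by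
  refine ext_entries_real ?_ ?_ ?_ ?_ <;> simp [cornerSegment, eq_div_of_posCorner]

theorem cornerSegment_self (g : PosCorner) (t : I) : cornerSegment (g, g, t) = g := by
  have h : ∀ x : ℝ, (1 - (t : ℝ)) * x + t * x = x := fun x => by ring
  refine ext_entries_real ?_ ?_ ?_ ?_ <;> simp [cornerSegment, h, eq_div_of_posCorner]

/-! ### The lift of the loop of a braid -/

/-- The path `s ↦ x^s` from `1` to `x`, for `x = L` or `R`. -/
def Letter.path (x : Letter) : Path (1 : SL(2, ℝ)) (toReal x.toSL) where
  toFun s := x.unipotent s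
  continuous_toFun := x.continuous_unipotent.comp continuous_subtype_val
  source' := by
    cases x <;> ext i j <;> fin_cases i <;> fin_cases j <;> simp [Letter.unipotent]
  target' := by
    refine ext_entries_real ?_ ?_ ?_ ?_ <;> rw [toReal_apply] <;>
      cases x <;> simp [Letter.unipotent, Letter.toSL]

theorem genLoop_toBraidLetter (x : Letter) : genLoop x.toBraidLetter = x.loop := by
  cases x <;> rfl

/-- The loop of a positive word in `L` and `R` lifts to a path of matrices with non-negative
entries. -/
theorem exists_lift_braidLoop (v : List Letter) :
    ∃ p : Path (1 : SL(2, ℝ)) (toReal (wordProd v)), (∀ s i j, 0 ≤ p s i j) ∧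
      ∀ s, braidLoop (v.map Letter.toBraidLetter) s = proj (p s) := by
  induction v with
  | nil =>
    have h : toReal (wordProd []) = 1 := map_one toReal
    refine ⟨(Path.refl 1).cast rfl h, ?_, fun s => rfl⟩
    intro s i j
    fin_cases i <;> fin_cases j <;> simp
  | cons x v ih =>
    obtain ⟨p, hp, hproj⟩ := ih
    have h : toReal (wordProd (x :: v)) = toReal x.toSL * toReal (wordProd v) := by
      rw [wordProd_cons, map_mul]
    -- The lift of the tail is translated by `x ∈ SL₂(ℤ)` to start where the path of `x` ends; its
    -- projection does not change.
    let p' : Path (toReal x.toSL) (toReal x.toSL * toReal (wordProd v)) :=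
      (p.map (continuous_const_mul (toReal x.toSL))).cast (mul_one _).symm rfl
    have hx : ∀ s i j, 0 ≤ x.path s i j := by
      intro s i j
      have hs := s.2.1
      change 0 ≤ x.unipotent s i j
      cases x <;> fin_cases i <;> fin_cases j <;> simp [Letter.unipotent, hs]
    have hx' : ∀ i j, 0 ≤ toReal x.toSL i j := by
      intro i j
      simpa using hx 1 i j
    have hp' : ∀ s i j, 0 ≤ p' s i j := by
      intro s i j
      change 0 ≤ (toReal x.toSL * p s) i j
      rw [mul_apply_real]
      exact add_nonneg (mul_nonneg (hx' _ _) (hp _ _ _)) (mul_nonneg (hx' _ _) (hp _ _ _))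
    refine ⟨(x.path.trans p').cast rfl h, ?_, ?_⟩
    · intro s i j
      rw [Path.cast_coe, Path.trans_apply]
      split_ifs
      · exact hx _ _ _
      · exact hp' _ _ _
    · intro s
      rw [List.map_cons, braidLoop, Path.cast_coe, Path.trans_apply, Path.trans_apply,
        genLoop_toBraidLetter]
      split_ifs
      · rfl
      · rw [hproj]
        exact (proj_mul x.toSL _).symm

theorem pos_corner_of_nonneg {g : SL(2, ℝ)} (h : ∀ i j, 0 ≤ g i j) : 0 < g 0 0 := by
  have hd := det_eq_real g
  refine lt_of_le_of_ne (h 0 0) fun h0 => ?_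
  rw [← h0] at hd
  nlinarith [mul_nonneg (h 0 1) (h 1 0)]

/-! ### Modular knots -/

theorem continuous_flow : Continuous flow := by
  refine Continuous.subtype_mk (continuous_matrix ?_) _
  intro i j
  fin_cases i <;> fin_cases j <;> simp <;> fun_prop

theorem flow_zero : flow 0 = 1 := by
  refine ext_entries_real ?_ ?_ ?_ ?_ <;> simp [flow]

/-- If the end point of the one-parameter group `s ↦ g · flow s · g⁻¹`, `0 ≤ s ≤ l`, has a positive
first entry, so have all its points. -/
theorem pos_corner_conj_flow {g : SL(2, ℝ)} {l : ℝ} (hl : 0 < l)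
    (h : 0 < (g * flow l * g⁻¹) 0 0) {s : ℝ} (hs : s ∈ I) :
    0 < (g * flow (s * l) * g⁻¹) 0 0 := by
  -- The second factor is affine in `e^{2r}`, with value `1` at `r = 0`, so its positivity at `l`
  -- implies positivity in between.
  have happ : ∀ r, (g * flow r * g⁻¹) 0 0 =
      Real.exp (-r) * (1 + g 0 0 * g 1 1 * (Real.exp r ^ 2 - 1)) := by
    intro r
    have hd := det_eq_real g
    have he : Real.exp (-r) * Real.exp r = 1 := by rw [← Real.exp_add]; simp
    rw [mul_apply_real, mul_apply_real, mul_apply_real, Matrix.SpecialLinearGroup.SL2_inv_expl]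
    simp [flow]
    linear_combination Real.exp (-r) * hd - g 0 0 * g 1 1 * Real.exp r * he
  rw [happ] at h ⊢
  have h' := (mul_pos_iff_of_pos_left (Real.exp_pos _)).mp h
  refine mul_pos (Real.exp_pos _) ?_
  have h1 : 1 ≤ Real.exp (s * l) := Real.one_le_exp (mul_nonneg hs.1 hl.le)
  have h2 : Real.exp (s * l) ≤ Real.exp l :=
    Real.exp_le_exp.mpr (mul_le_of_le_one_left hl.le hs.2)
  rcases le_or_gt 0 (g 0 0 * g 1 1) with h3 | h3
  · nlinarith [mul_nonneg h3 (by nlinarith : (0 : ℝ) ≤ Real.exp (s * l) ^ 2 - 1)]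
  · nlinarith [mul_nonneg (neg_nonneg.mpr h3.le)
      (by nlinarith : (0 : ℝ) ≤ Real.exp l ^ 2 - Real.exp (s * l) ^ 2)]

/-- Non-negativity excludes trace less than `-2`, and a zero upper entry would make both diagonal
entries `1`. -/
theorem trace_gt_two_and_upper_pos (A : SL2N) (hA : (A : SL(2, ℤ)).val.IsHyperbolic) :
    2 < A.1 0 0 + A.1 1 1 ∧ 0 < A.1 0 1 := by
  have hd := det_eq A.1
  have h00 := A.2 0 0
  have h01 := A.2 0 1
  have h10 := A.2 1 0
  have h11 := A.2 1 1
  rw [Matrix.IsHyperbolic, Matrix.discr_fin_two, Matrix.SpecialLinearGroup.det_coe,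
    Matrix.trace_fin_two] at hA
  have ht : 2 < A.1 0 0 + A.1 1 1 := by
    change 0 < (A.1 0 0 + A.1 1 1) ^ 2 - 4 * 1 at hA
    nlinarith
  refine ⟨ht, lt_of_le_of_ne h01 fun h0 => ?_⟩
  rw [← h0] at hd
  rcases Int.mul_eq_one_iff_eq_one_or_neg_one.mp (by linarith : A.1 0 0 * A.1 1 1 = 1) with h | h <;>
    omega

theorem exists_isModularKnot (A : SL2N) (hA : (A : SL(2, ℤ)).val.IsHyperbolic) :
    ∃ γ, IsModularKnot A γ := by
  obtain ⟨ht, hb⟩ := trace_gt_two_and_upper_pos A hA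
  have hd : toReal A.1 0 0 * toReal A.1 1 1 - toReal A.1 0 1 * toReal A.1 1 0 = 1 :=
    det_eq_real _
  have ht' : 2 < toReal A.1 0 0 + toReal A.1 1 1 := by
    rw [toReal_apply, toReal_apply]
    exact_mod_cast ht
  have hb' : 0 < toReal A.1 0 1 := by
    rw [toReal_apply]
    exact_mod_cast hb
  set a := toReal A.1 0 0
  set b := toReal A.1 0 1
  set c := toReal A.1 1 0
  set d := toReal A.1 1 1
  obtain ⟨D, hD, hDD⟩ : ∃ D : ℝ, 0 < D ∧ D ^ 2 = (a + d) ^ 2 - 4 :=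
    ⟨√((a + d) ^ 2 - 4), Real.sqrt_pos.mpr (by nlinarith), Real.sq_sqrt (by nlinarith)⟩
  set m := (a + d + D) / 2 with hm
  have hm1 : 1 < m := by rw [hm]; linarith
  have hexp : Real.exp (Real.log m) = m := Real.exp_log (by linarith)
  have hexp' : Real.exp (-Real.log m) = (a + d - D) / 2 := by
    rw [Real.exp_neg, hexp, inv_eq_iff_eq_inv, eq_comm, inv_eq_of_mul_eq_one_right]
    rw [hm]
    linear_combination -hDD / 4
  -- The columns are eigenvectors `(b, m - a)` and `(b, m⁻¹ - a)`, the second scaled by `-1 / (b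
  -- D)`; as `m - m⁻¹ = D`, the determinant is `1`.
  let g : SL(2, ℝ) := ⟨!![b, -1 / D; m - a, -((a + d - D) / 2 - a) / (b * D)], by
    rw [Matrix.det_fin_two_of, hm]
    field_simp
    ring⟩
  refine ⟨⟨fun s => proj (g * flow (s * Real.log m)), continuous_proj.comp
    (continuous_const.mul (continuous_flow.comp (by fun_prop)))⟩, g, Real.log m,
    Real.log_pos hm1, ?_, fun s => rfl⟩
  refine ext_entries_real ?_ ?_ ?_ ?_ <;> rw [mul_apply_real, mul_apply_real]
  · change a * b + b * (m - a) = b * Real.exp (Real.log m) + -1 / D * 0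
    rw [hexp]
    ring
  · change a * (-1 / D) + b * (-((a + d - D) / 2 - a) / (b * D)) =
      b * 0 + -1 / D * Real.exp (-Real.log m)
    rw [hexp']
    field_simp
    ring
  · change c * b + d * (m - a) =
      (m - a) * Real.exp (Real.log m) + -((a + d - D) / 2 - a) / (b * D) * 0
    rw [hexp, hm]
    linear_combination -hd - hDD / 4
  · change c * (-1 / D) + d * (-((a + d - D) / 2 - a) / (b * D)) =
      (m - a) * 0 + -((a + d - D) / 2 - a) / (b * D) * Real.exp (-Real.log m)
    rw [hexp']
    field_simp
    linear_combination 4 * hd + hDD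

theorem freelyHomotopic_braidLoop_modularKnot (A : SL2N)
    (hA : (A : SL(2, ℤ)).val.IsHyperbolic) {γ : C(I, UnitTangent)} (hγ : IsModularKnot A γ) :
    FreelyHomotopic (braidLoop (sigmaWord A)).toContinuousMap γ := by
  obtain ⟨ht, hb⟩ := trace_gt_two_and_upper_pos A hA
  obtain ⟨g, l, hl, hg, hγ, hpos⟩ : ∃ (g : SL(2, ℝ)) (l : ℝ), 0 < l ∧
      toReal A.1 * g = g * flow l ∧ (∀ s : I, γ s = proj (g * flow (s * l))) ∧ 0 < g 0 0 := by
    obtain ⟨g, l, hl, hg, hγ⟩ := hγ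
    -- The first column of `g` is an eigenvector of `A`; since the upper right entry of `A` is
    -- non-zero, a zero first coordinate would make the column vanish.
    have hne : g 0 0 ≠ 0 := by
      intro h0
      have hd := det_eq_real g
      have h : (A.1 0 0 : ℝ) * g 0 0 + A.1 0 1 * g 1 0 =
          g 0 0 * Real.exp l + g 0 1 * 0 := by
        have h := congrArg (fun x : SL(2, ℝ) => x 0 0) hg
        simp only [mul_apply_real] at h
        exact h
      have hb' : (A.1 0 1 : ℝ) ≠ 0 := by exact_mod_cast hb.ne'
      rw [h0] at h hd
      have h10 : g 1 0 = 0 := by simpa [hb'] using h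
      rw [h10] at hd
      simp at hd
    rcases lt_or_gt_of_ne hne with hlt | hgt
    -- As `-1 ∈ SL₂(ℤ)`, the matrix `-g` defines the same orbit.
    · refine ⟨toReal (-1) * g, l, hl, ?_, ?_, ?_⟩
      · rw [mul_assoc, ← hg, ← mul_assoc, ← mul_assoc, ← map_mul, ← map_mul]
        simp
      · intro s
        rw [hγ, mul_assoc, proj_mul]
      · rw [mul_apply_real, toReal_apply, toReal_apply]
        simpa using hlt
    · exact ⟨g, l, hl, hg, hγ, hgt⟩
  have hA1 : g * flow l * g⁻¹ = toReal A.1 := by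
    rw [← hg, mul_inv_cancel_right]
  have hw : wordProd (word A) = A.1 := (existsUnique_word A).choose_spec.1
  obtain ⟨p, hp, hproj⟩ := exists_lift_braidLoop (word A)
  have hApos : 0 < (g * flow l * g⁻¹) 0 0 := by
    rw [hA1, ← hw, ← p.target]
    exact pos_corner_of_nonneg (hp 1)
  let α : I → PosCorner := fun s => ⟨p s, pos_corner_of_nonneg (hp s)⟩
  have hα : Continuous α := p.continuous.subtype_mk _
  let β : I → PosCorner := fun s => ⟨g * flow (s * l) * g⁻¹, pos_corner_conj_flow hl hApos s.2⟩
  have hβ : Continuous β := by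
    refine Continuous.subtype_mk ((continuous_const.mul
      (continuous_flow.comp (by fun_prop))).mul continuous_const) _
  have hα0 : (α 0).1 = 1 := p.source
  have hα1 : (α 1).1 = toReal A.1 := p.target.trans (by rw [hw])
  have hβ0 : (β 0).1 = 1 := by simp [β, flow_zero]
  have hβ1 : (β 1).1 = toReal A.1 := by simp [β, hA1]
  let γ' : C(I, UnitTangent) :=
    ⟨fun s => proj (β s), continuous_proj.comp (continuous_subtype_val.comp hβ)⟩
  -- The lifts `α` and `β` have the same ends, and `cornerSegment` is constant between equal points.
  have h1 : FreelyHomotopic (braidLoop (sigmaWord A)).toContinuousMap γ' := by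
    refine freelyHomotopic_of_lift A.1 (H := fun x => cornerSegment (α x.2, β x.2, x.1))
      (continuous_cornerSegment.comp (by fun_prop)) ?_ ?_ ?_
    · intro t
      have e0 : α 0 = β 0 := Subtype.ext (hα0.trans hβ0.symm)
      have e1 : α 1 = β 1 := Subtype.ext (hα1.trans hβ1.symm)
      simp only [e0, e1, cornerSegment_self, hβ0, hβ1, mul_one]
    · intro s
      simp only [cornerSegment_zero]
      exact hproj s
    · intro s
      simp only [cornerSegment_one]
      rfl
  -- Right multiplication of `β` by a path from `1` to `g` leads to `g * flow`, and commutes with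
  -- the left action of `A` that relates the ends.
  have h2 : FreelyHomotopic γ' γ := by
    refine freelyHomotopic_of_lift A.1
      (H := fun x => (β x.2).1 * cornerSegment (⟨1, by simp⟩, ⟨g, hpos⟩, x.1))
      ((continuous_subtype_val.comp (hβ.comp continuous_snd)).mul
        (continuous_cornerSegment.comp (by fun_prop))) ?_ ?_ ?_
    · intro t
      simp only [hβ0, hβ1, one_mul]
    · intro s
      simp only [cornerSegment_zero, mul_one]
      rfl
    · intro s
      simp only [cornerSegment_one, β, inv_mul_cancel_right]
      exact hγ s
  exact h1.trans h2

end ModularBraid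

end

/-! ### Modular knots, their braids and Alexander polynomials -/

theorem mainTheorem10 (A : ModularBraid.SL2N)
    (hhyp : (A : SL(2, ℤ)).val.IsHyperbolic)
    (hprim : ModularBraid.IsPrimitiveElement
      (QuotientGroup.mk (A : SL(2, ℤ)) : Matrix.ProjectiveSpecialLinearGroup (Fin 2) ℤ)) :
    ((∃ γ, ModularBraid.IsModularKnot A γ) ∧
      ∀ γ, ModularBraid.IsModularKnot A γ →
        ModularBraid.FreelyHomotopic
          (ModularBraid.braidLoop (ModularBraid.sigmaWord A)).toContinuousMap γ) ∧
    ∀ w : ModularBraid.BraidWord, IsConj w.toBraid (ModularBraid.sigma A) →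
      (∃ P, (ModularBraid.closure w).IsAlexanderPolynomial P) ∧
      ∀ P, (ModularBraid.closure w).IsAlexanderPolynomial P →
        Associated
          (ModularBraid.substNegSq P *
            (LaurentPolynomial.T 2 - 1 + LaurentPolynomial.T (-2)))
          (LaurentPolynomial.T (ModularBraid.Rad A) - (ModularBraid.deform A).trace +
            LaurentPolynomial.T (-ModularBraid.Rad A)) := by
  refine ⟨⟨ModularBraid.exists_isModularKnot A hhyp, fun γ hγ =>
    ModularBraid.freelyHomotopic_braidLoop_modularKnot A hhyp hγ⟩, fun w hw =>
    ⟨ModularBraid.exists_isAlexanderPolynomial_closure w, fun P hP =>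
      ModularBraid.associated_substNegSq_alexander A w hw hP⟩⟩
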